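/- There are a single algorithm, a polynomial $p$ and a constant $c$ such that the following holds. Given a simple graph $G$ on $n$ vertices (as an adjacency matrix) and an integer $k\ge 0$, the algorithm decides whether the vertex set of $G$ is the union of $k$ (not necessarily distinct) independent sets of $G$, where a set of vertices is independent if no two of its members are adjacent; and if $\Delta$ is the maximum degree of $G$ (with $\Delta=0$ when $n=0$), then its running time is at most \[ p(n)\cdot\bigl(2^{\Delta+1}-1\bigr)^{n/(\Delta+1)}+c\cdot\mathrm{len}(k), \] where $\mathrm{len}(k)$ is the number of binary digits of $k$ (and $\mathrm{len}(0)=0$). Thus, for $k\le n$, one can decide in time $O^*\bigl((2^{\Delta+1}-1)^{n/(\Delta+1)}\bigr)$ whether $G$ admits a covering with $k$ independent sets, where $O^*$ suppresses factors that are polynomial in $n$. Running time is measured on a random access machine over the natural numbers with the logarithmic cost criterion, that is, every value and address that an operation uses is charged its bit length. The algorithm, $p$ and $c$ depend neither on $G$ nor on $n$, $\Delta$, $k$. -/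

import Mathlib

/-! A random access machine over the natural numbers with the logarithmic cost criterion. It has
registers (addressed by constants of the program) and a memory (addressed by computed values).
Every value that is touched is charged its bit length, so no step can work on a long number for
free. Programs are built from assignments, sequencing, conditionals and loops. -/

namespace Ram

/-- The contents of the registers and of the memory cells. -/
structure State where
  reg : ℕ → ℕ
  mem : ℕ → ℕ

/-- Arithmetic expressions. -/
inductive Expr where
  | const (c : ℕ)
  | reg (i : ℕ)
  /-- the content of the memory cell whose address is the value of `a` -/
  | load (a : Expr)
  | add (a b : Expr)
  /-- truncated subtraction -/
  | sub (a b : Expr)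
  | mul (a b : Expr)
  /-- quotient rounded down, with `x / 0 = 0` -/
  | div (a b : Expr)

/-- The value of an expression in a state. -/
def Expr.val (s : State) : Expr → ℕ
  | const c => c
  | reg i => s.reg i
  | load a => s.mem (a.val s)
  | add a b => a.val s + b.val s
  | sub a b => a.val s - b.val s
  | mul a b => a.val s * b.val s
  | div a b => a.val s / b.val s

/-- The cost of evaluating an expression: each node of the expression tree costs one plus the bit
length of its value. Operands and addresses are subexpressions, so their bit lengths are charged
as well. -/
def Expr.cost (s : State) : Expr → ℕ
  | const c => 1 + Nat.size c
  | reg i => 1 + Nat.size (s.reg i)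
  | load a => 1 + Nat.size (s.mem (a.val s)) + a.cost s
  | add a b => 1 + Nat.size (a.val s + b.val s) + a.cost s + b.cost s
  | sub a b => 1 + Nat.size (a.val s - b.val s) + a.cost s + b.cost s
  | mul a b => 1 + Nat.size (a.val s * b.val s) + a.cost s + b.cost s
  | div a b => 1 + Nat.size (a.val s / b.val s) + a.cost s + b.cost s

/-- Programs. -/
inductive Prog where
  | skip
  /-- assign the value of `e` to register `i` -/
  | set (i : ℕ) (e : Expr)
  /-- assign the value of `e` to the memory cell whose address is the value of `a` -/
  | store (a e : Expr)
  | seq (p q : Prog)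
  /-- run `p` if the value of `e` is nonzero, and `q` otherwise -/
  | cond (e : Expr) (p q : Prog)
  /-- repeat `p` as long as the value of `e` is nonzero -/
  | loop (e : Expr) (p : Prog)

/-- `Runs p s t s'`: started in state `s`, the program `p` halts in state `s'` at total cost `t`. -/
inductive Runs : Prog → State → ℕ → State → Prop where
  | skip (s : State) : Runs .skip s 1 s
  | set (i : ℕ) (e : Expr) (s : State) :
      Runs (.set i e) s (1 + e.cost s) ⟨Function.update s.reg i (e.val s), s.mem⟩
  | store (a e : Expr) (s : State) :
      Runs (.store a e) s (1 + a.cost s + e.cost s)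
        ⟨s.reg, Function.update s.mem (a.val s) (e.val s)⟩
  | seq {p q : Prog} {s s' s'' : State} {t t' : ℕ} (hp : Runs p s t s') (hq : Runs q s' t' s'') :
      Runs (.seq p q) s (t + t') s''
  | cond_true {e : Expr} {p q : Prog} {s s' : State} {t : ℕ} (he : e.val s ≠ 0)
      (hp : Runs p s t s') : Runs (.cond e p q) s (1 + e.cost s + t) s'
  | cond_false {e : Expr} {p q : Prog} {s s' : State} {t : ℕ} (he : e.val s = 0)
      (hq : Runs q s t s') : Runs (.cond e p q) s (1 + e.cost s + t) s'
  | loop_done {e : Expr} {p : Prog} {s : State} (he : e.val s = 0) :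
      Runs (.loop e p) s (1 + e.cost s) s
  | loop_step {e : Expr} {p : Prog} {s s' s'' : State} {t t' : ℕ} (he : e.val s ≠ 0)
      (hp : Runs p s t s') (hl : Runs (.loop e p) s' t' s'') :
      Runs (.loop e p) s (1 + e.cost s + t + t') s''

/-- The final state and the cost of a run are determined by the program and the initial state. -/
theorem Runs.unique {p : Prog} {s s₁ s₂ : State} {t₁ t₂ : ℕ} (h₁ : Runs p s t₁ s₁)
    (h₂ : Runs p s t₂ s₂) : t₁ = t₂ ∧ s₁ = s₂ := by
  induction h₁ generalizing t₂ s₂ with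
  | skip | set | store => cases h₂; exact ⟨rfl, rfl⟩
  | seq _ _ ihp ihq =>
    cases h₂ with
    | seq hp hq =>
      obtain ⟨rfl, rfl⟩ := ihp hp
      obtain ⟨rfl, rfl⟩ := ihq hq
      exact ⟨rfl, rfl⟩
  | cond_true he _ ih =>
    cases h₂ with
    | cond_true _ hp => obtain ⟨rfl, rfl⟩ := ih hp; exact ⟨rfl, rfl⟩
    | cond_false he' _ => exact absurd he' he
  | cond_false he _ ih =>
    cases h₂ with
    | cond_true he' _ => exact absurd he he'
    | cond_false _ hq => obtain ⟨rfl, rfl⟩ := ih hq; exact ⟨rfl, rfl⟩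
  | loop_done he =>
    cases h₂ with
    | loop_done _ => exact ⟨rfl, rfl⟩
    | loop_step he' _ _ => exact absurd he he'
  | loop_step he _ _ ihp ihl =>
    cases h₂ with
    | loop_done he' => exact absurd he' he
    | loop_step _ hp hl =>
      obtain ⟨rfl, rfl⟩ := ihp hp
      obtain ⟨rfl, rfl⟩ := ihl hl
      exact ⟨rfl, rfl⟩

open Classical in
/-- The initial state for a graph `G` on the vertices `0, …, n - 1` and a number `k`: register 0
holds `n`, register 1 holds `k`, the memory cells `0, …, n ^ 2 - 1` hold the adjacency matrix of
`G` row by row, and everything else is zero. -/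
noncomputable def graphInput {n : ℕ} (G : SimpleGraph (Fin n)) (k : ℕ) : State where
  reg i := if i = 0 then n else if i = 1 then k else 0
  mem a := if ∃ u v : Fin n, a = u * n + v ∧ G.Adj u v then 1 else 0

end Ram

/-- The vertex set of `G` is the union of `k` (not necessarily distinct) independent sets. -/
def CoveredByIndepSets {V : Type*} (G : SimpleGraph V) (k : ℕ) : Prop :=
  ∃ S : Fin k → Set V, (∀ i, G.IsIndepSet (S i)) ∧ ⋃ i, S i = Set.univ

/-! Call a set of vertices dominating if it meets every closed neighbourhood. An independent set
lies in a maximal one, and the maximal independent sets are exactly the independent dominating sets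
(`kernels`), so it suffices to count the `k`-tuples of kernels that cover all vertices. Let `z S` be
the number of kernels inside `S`. Then `z S ^ k` counts the `k`-tuples of kernels inside `S`, and
Möbius inversion over subsets turns this into the number of tuples with union `S`.

Done over all subsets this costs `2 ^ n`. For `k > 0` the transforms can be trimmed: every superset
of a kernel is dominating, so all tables vanish away from the dominating sets
(`mem_dominators_of_kernel`). Domination passes to supersets, so all dominating sets arise from the
full vertex set by deciding for one vertex after another whether to delete it, never leaving the
family (`mem_dominators`). Both transforms run in place over this list, one vertex at a time
(`zeta_succ`, `covers_succ`). Each intermediate table counts something, so subtraction of natural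
numbers is never truncated. Thus the time is polynomial in `n` per dominating set.

The number of dominating sets is bounded by Shearer's inequality (`card_pow_le_prod_card_trace`),
applied to the closed neighbourhoods: on a closed neighbourhood with `d` elements a dominating set
leaves one of at most `2 ^ d - 1` traces, the empty one being excluded. Padding with singletons
makes each vertex be covered `Δ + 1` times.

If `k ≥ n`, singletons cover the graph, and `k = 0` is decided by `n`. Otherwise all numbers have
`O(n ^ 2)` bits, so logarithmic cost adds only a polynomial factor. -/

namespace Ram

-- Cost calculus for programs on bounded numbers.

attribute [simp] Expr.val

/-- The number of nodes of an expression. -/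
def Expr.nodes : Expr → ℕ
  | const _ => 1
  | reg _ => 1
  | load a => a.nodes + 1
  | add a c => a.nodes + c.nodes + 1
  | sub a c => a.nodes + c.nodes + 1
  | mul a c => a.nodes + c.nodes + 1
  | div a c => a.nodes + c.nodes + 1

/-- All constants, registers and memory cells that `e` reads in state `s` are below `b`. -/
def Expr.Ok (b : ℕ) (s : State) : Expr → Prop
  | const c => c < b
  | reg i => s.reg i < b
  | load a => a.Ok b s ∧ s.mem (a.val s) < b
  | add a c => a.Ok b s ∧ c.Ok b s
  | sub a c => a.Ok b s ∧ c.Ok b s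
  | mul a c => a.Ok b s ∧ c.Ok b s
  | div a c => a.Ok b s ∧ c.Ok b s

attribute [simp] Expr.Ok

theorem size_add_le (x y : ℕ) : Nat.size (x + y) ≤ Nat.size x + Nat.size y + 1 := by
  rw [Nat.size_le]
  have hx := Nat.lt_size_self x
  have hy := Nat.lt_size_self y
  have h1 : 2 ^ x.size ≤ 2 ^ (x.size + y.size) := Nat.pow_le_pow_right (by norm_num) (by omega)
  have h2 : 2 ^ y.size ≤ 2 ^ (x.size + y.size) := Nat.pow_le_pow_right (by norm_num) (by omega)
  rw [pow_succ]
  omega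

theorem size_mul_le (x y : ℕ) : Nat.size (x * y) ≤ Nat.size x + Nat.size y := by
  rw [Nat.size_le, pow_add]
  exact Nat.mul_lt_mul'' (Nat.lt_size_self x) (Nat.lt_size_self y)

/-- An operation yields at most one bit more than its operands have together, so only the leaves and
loaded cells need to be below `b`, not the intermediate results. -/
theorem Expr.Ok.size_val_le {b : ℕ} {s : State} {e : Expr} (h : e.Ok b s) :
    Nat.size (e.val s) ≤ e.nodes * (Nat.size b + 1) := by
  have leaf {x : ℕ} (hx : x < b) : Nat.size x ≤ Nat.size b := Nat.size_le_size hx.le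
  induction e with
  | const c => simpa [Expr.val, Expr.nodes] using (leaf h).trans (Nat.le_succ _)
  | reg i => simpa [Expr.val, Expr.nodes] using (leaf h).trans (Nat.le_succ _)
  | load a _ =>
    have := leaf h.2
    simp only [Expr.val, Expr.nodes, add_mul]
    omega
  | add a c iha ihc =>
    have := size_add_le (a.val s) (c.val s)
    have := iha h.1
    have := ihc h.2
    simp only [Expr.val, Expr.nodes, add_mul] at *
    omega
  | sub a c iha ihc =>
    have := Nat.size_le_size (Nat.sub_le (a.val s) (c.val s))
    have := iha h.1
    simp only [Expr.val, Expr.nodes, add_mul] at *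
    omega
  | mul a c iha ihc =>
    have := size_mul_le (a.val s) (c.val s)
    have := iha h.1
    have := ihc h.2
    simp only [Expr.val, Expr.nodes, add_mul] at *
    omega
  | div a c iha ihc =>
    have := Nat.size_le_size (Nat.div_le_self (a.val s) (c.val s))
    have := iha h.1
    simp only [Expr.val, Expr.nodes, add_mul] at *
    omega

theorem Expr.Ok.cost_le_of_le {b M : ℕ} {s : State} {e : Expr} (h : e.Ok b s)
    (hM : e.nodes * (Nat.size b + 1) ≤ M) : e.cost s ≤ e.nodes * (1 + M) := by
  induction e with
  | const c | reg i =>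
    have := h.size_val_le
    simp only [Expr.val, Expr.nodes, Expr.cost] at *
    omega
  | load a iha =>
    have := h.size_val_le
    have := iha h.1 (by simp only [Expr.nodes, add_mul] at hM; omega)
    simp only [Expr.val, Expr.nodes, Expr.cost, add_mul] at *
    omega
  | add a c iha ihc | sub a c iha ihc | mul a c iha ihc | div a c iha ihc =>
    have := h.size_val_le
    have := iha h.1 (by simp only [Expr.nodes, add_mul] at hM; omega)
    have := ihc h.2 (by simp only [Expr.nodes, add_mul] at hM; omega)
    simp only [Expr.val, Expr.nodes, Expr.cost, add_mul] at *
    omega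

/-- A bound on the cost of one instruction that works with numbers below `b`. -/
def unit (b : ℕ) : ℕ := 4000 * (Nat.size b + 2)

/-- The factor is `40 ^ 2`: at most 40 nodes, each with a value of at most 40 times the basic
length. An instruction evaluates at most two expressions, whence the constant in `unit`. -/
theorem Expr.Ok.cost_le {b : ℕ} {s : State} {e : Expr} (h : e.Ok b s) (hn : e.nodes ≤ 40) :
    e.cost s ≤ 1600 * (Nat.size b + 2) := by
  refine (h.cost_le_of_le le_rfl).trans ?_
  calc e.nodes * (1 + e.nodes * (Nat.size b + 1))
      ≤ 40 * (1 + 40 * (Nat.size b + 1)) := by gcongr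
    _ ≤ _ := by omega

/-- Started in `s`, the program `P` halts in `s'` at the cost of at most `N` instructions on
numbers below `b`. -/
def Ex (b : ℕ) (P : Prog) (N : ℕ) (s s' : State) : Prop :=
  ∃ t, Runs P s t s' ∧ t ≤ N * unit b

theorem Ex.mono {b N N' : ℕ} {P : Prog} {s s' : State} (h : Ex b P N s s') (hN : N ≤ N') :
    Ex b P N' s s' := by
  obtain ⟨t, hr, ht⟩ := h
  exact ⟨t, hr, ht.trans (Nat.mul_le_mul_right _ hN)⟩

theorem Ex.skip {b N : ℕ} {s s' : State} (h : s = s') : Ex b .skip (N + 1) s s' := by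
  subst h
  refine ⟨1, .skip s, ?_⟩
  rw [add_mul, unit]
  omega

theorem Ex.seq {b N N' : ℕ} {P Q : Prog} {s s' s'' : State} (h : Ex b P N s s')
    (h' : Ex b Q N' s' s'') : Ex b (.seq P Q) (N + N') s s'' := by
  obtain ⟨t, hr, ht⟩ := h
  obtain ⟨t', hr', ht'⟩ := h'
  exact ⟨t + t', hr.seq hr', by rw [add_mul]; omega⟩

/-- The state with register contents `l` (and zeros after them) and memory contents `m`. -/
def St (l : List ℕ) (m : ℕ → ℕ) : State := ⟨fun i => l.getD i 0, m⟩

@[simp] theorem St_reg (l : List ℕ) (m : ℕ → ℕ) (i : ℕ) : (St l m).reg i = l.getD i 0 := rfl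

@[simp] theorem St_mem (l : List ℕ) (m : ℕ → ℕ) : (St l m).mem = m := rfl

theorem update_getD (l : List ℕ) {i : ℕ} (hi : i < l.length) (x : ℕ) :
    Function.update (fun j => l.getD j 0) i x = fun j => (l.set i x).getD j 0 := by
  funext j
  rcases eq_or_ne j i with rfl | hj
  · simp [hi]
  · simp [hj, List.getElem?_set_ne hj.symm]

theorem Ex.set {b : ℕ} {l : List ℕ} {m : ℕ → ℕ} {i : ℕ} {e : Expr} (he : e.Ok b (St l m))
    (hn : e.nodes ≤ 40) (hi : i < l.length) :
    Ex b (.set i e) 1 (St l m) (St (l.set i (e.val (St l m))) m) := by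
  refine ⟨1 + e.cost (St l m), ?_, ?_⟩
  · have := Runs.set i e (St l m)
    rwa [St, update_getD l hi] at this
  · have := he.cost_le hn
    simp only [unit] at *
    omega

theorem Ex.store {b : ℕ} {l : List ℕ} {m : ℕ → ℕ} {a e : Expr} (ha : a.Ok b (St l m))
    (he : e.Ok b (St l m)) (hna : a.nodes ≤ 40) (hn : e.nodes ≤ 40) :
    Ex b (.store a e) 1 (St l m)
      (St l (Function.update m (a.val (St l m)) (e.val (St l m)))) := by
  refine ⟨_, .store a e (St l m), ?_⟩
  have := he.cost_le hn
  have := ha.cost_le hna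
  simp only [unit] at *
  omega

theorem Ex.cond_true {b N : ℕ} {P Q : Prog} {e : Expr} {s s' : State} (he : e.Ok b s)
    (hn : e.nodes ≤ 40) (h0 : e.val s ≠ 0) (h : Ex b P N s s') :
    Ex b (.cond e P Q) (N + 1) s s' := by
  obtain ⟨t, hr, ht⟩ := h
  refine ⟨_, .cond_true h0 hr, ?_⟩
  have := he.cost_le hn
  rw [add_mul]
  simp only [unit] at *
  omega

theorem Ex.cond_false {b N : ℕ} {P Q : Prog} {e : Expr} {s s' : State} (he : e.Ok b s)
    (hn : e.nodes ≤ 40) (h0 : e.val s = 0) (h : Ex b Q N s s') :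
    Ex b (.cond e P Q) (N + 1) s s' := by
  obtain ⟨t, hr, ht⟩ := h
  refine ⟨_, .cond_false h0 hr, ?_⟩
  have := he.cost_le hn
  rw [add_mul]
  simp only [unit] at *
  omega

/-- A loop that passes through the states `σ 0, …, σ m`. -/
theorem Ex.loop {b N m : ℕ} {P : Prog} {e : Expr} (σ : ℕ → State) (hn : e.nodes ≤ 40)
    (hok : ∀ j ≤ m, e.Ok b (σ j)) (h1 : ∀ j < m, e.val (σ j) ≠ 0) (h0 : e.val (σ m) = 0)
    (h : ∀ j < m, Ex b P N (σ j) (σ (j + 1))) :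
    Ex b (.loop e P) (m * (N + 1) + 1) (σ 0) (σ m) := by
  induction m generalizing σ with
  | zero =>
    refine ⟨_, .loop_done h0, ?_⟩
    have := (hok 0 le_rfl).cost_le hn
    simp only [unit] at *
    omega
  | succ m ih =>
    obtain ⟨t, hr, ht⟩ := h 0 (Nat.succ_pos m)
    obtain ⟨t', hr', ht'⟩ := ih (fun j => σ (j + 1)) (fun j hj => hok _ (by omega))
      (fun j hj => h1 _ (by omega)) h0 (fun j hj => h _ (by omega))
    refine ⟨_, .loop_step (h1 0 (Nat.succ_pos m)) hr hr', ?_⟩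
    have := (hok 0 (Nat.zero_le _)).cost_le hn
    simp only [add_mul, one_mul] at *
    simp only [unit] at *
    omega

/-- Sequential composition of a list of programs. -/
def block : List Prog → Prog
  | [] => .skip
  | P :: l => .seq P (block l)

theorem Ex.nil {b N : ℕ} {s s' : State} (h : s = s') : Ex b (block []) (N + 1) s s' := Ex.skip h

theorem Ex.cons {b N N' : ℕ} {P : Prog} {l : List Prog} {s s' s'' : State} (h : Ex b P N s s')
    (h' : Ex b (block l) N' s' s'') : Ex b (block (P :: l)) (N' + N) s s'' := by
  rw [add_comm]
  exact h.seq h'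

theorem Ex.cons_set {b N : ℕ} {l : List ℕ} {m : ℕ → ℕ} {i : ℕ} {e : Expr} {ps : List Prog}
    {s : State} (he : e.Ok b (St l m)) (hn : e.nodes ≤ 40) (hi : i < l.length)
    (h : Ex b (block ps) N (St (l.set i (e.val (St l m))) m) s) :
    Ex b (block (.set i e :: ps)) (N + 1) (St l m) s :=
  (Ex.set he hn hi).cons h

theorem Ex.cons_store {b N : ℕ} {l : List ℕ} {m : ℕ → ℕ} {a e : Expr} {ps : List Prog}
    {s : State} (ha : a.Ok b (St l m)) (he : e.Ok b (St l m)) (hna : a.nodes ≤ 40)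
    (hn : e.nodes ≤ 40)
    (h : Ex b (block ps) N
      (St l (Function.update m (a.val (St l m)) (e.val (St l m)))) s) :
    Ex b (block (.store a e :: ps)) (N + 1) (St l m) s :=
  (Ex.store ha he hna hn).cons h

/-! ### Sets as binary numbers, and the memory layout. -/

/-- The number with binary digits `S`. -/
def code (S : Finset ℕ) : ℕ := ∑ i ∈ S, 2 ^ i

theorem code_bitIndices (x : ℕ) : code x.bitIndices.toFinset = x :=
  Finset.sum_toFinset_bitIndices_two_pow x

theorem bitIndices_code (S : Finset ℕ) : (code S).bitIndices.toFinset = S :=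
  Finset.toFinset_bitIndices_sum_two_pow S

/-- The machine has no remainder operation; this is the form in which `Expr.parity` reads a binary
digit. -/
theorem code_div_mod (S : Finset ℕ) (u : ℕ) :
    code S / 2 ^ u - code S / 2 ^ u / 2 * 2 = if u ∈ S then 1 else 0 := by
  have h : (code S).testBit u ↔ u ∈ S := by
    rw [← Nat.mem_bitIndices, ← List.mem_toFinset, bitIndices_code]
  rw [Nat.testBit_eq_decide_div_mod_eq] at h
  simp only [decide_eq_true_eq] at h
  split_ifs with hu
  · have := h.2 hu
    omega
  · have : ¬ _ := fun h' => hu (h.1 h')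
    omega

theorem code_erase {S : Finset ℕ} {i : ℕ} (h : i ∈ S) : code S - 2 ^ i = code (S.erase i) := by
  rw [code, ← Finset.add_sum_erase S _ h, code]
  omega

theorem code_range (n : ℕ) : code (Finset.range n) = 2 ^ n - 1 := by
  have := Nat.geomSum_eq (le_refl 2) n
  simpa [code] using this

theorem code_lt {S : Finset ℕ} {n : ℕ} (h : S ⊆ Finset.range n) : code S < 2 ^ n := by
  have h1 : code S ≤ code (Finset.range n) := Finset.sum_le_sum_of_subset h
  have h2 := Nat.two_pow_pos n
  rw [code_range] at h1
  omega

/-- Memory contents: the cells below `n ^ 2` hold `A`, then a table `g` of values of sets at the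
even offsets is interleaved with a list `l` of sets at the odd offsets. -/
def memo (n : ℕ) (A : ℕ → ℕ) (l : List (Finset ℕ)) (g : Finset ℕ → ℕ) (a : ℕ) : ℕ :=
  if a < n * n then A a
  else if (a - n * n) % 2 = 0 then g ((a - n * n) / 2).bitIndices.toFinset
  -- Past the end of the list the default `∅` has code 0, in agreement with untouched memory.
  else code (l[(a - n * n) / 2]?.getD ∅)

section

variable (n : ℕ) (A : ℕ → ℕ) (l : List (Finset ℕ)) (g : Finset ℕ → ℕ)

@[simp] theorem memo_adj {v u : ℕ} (hv : v < n) (hu : u < n) :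
    memo n A l g (v * n + u) = A (v * n + u) := by
  rw [memo, if_pos]
  nlinarith

@[simp] theorem memo_table (S : Finset ℕ) : memo n A l g (n * n + 2 * code S) = g S := by
  simp [memo, bitIndices_code]

@[simp] theorem memo_list (j : ℕ) :
    memo n A l g (n * n + (2 * j + 1)) = code (l[j]?.getD ∅) := by
  rw [memo, if_neg (by omega), if_neg (by omega)]
  congr 3
  omega

@[simp] theorem update_memo_table (S : Finset ℕ) (x : ℕ) :
    Function.update (memo n A l g) (n * n + 2 * code S) x =
      memo n A l (Function.update g S x) := by
  funext a
  rcases eq_or_ne a (n * n + 2 * code S) with rfl | ha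
  · simp
  rw [Function.update_of_ne ha]
  unfold memo
  split_ifs with h1 h2
  · rfl
  · rw [Function.update_of_ne]
    rintro rfl
    rw [code_bitIndices] at ha
    omega
  · rfl

@[simp] theorem update_memo_list (S : Finset ℕ) :
    Function.update (memo n A l g) (n * n + (2 * l.length + 1)) (code S) =
      memo n A (l ++ [S]) g := by
  funext a
  rcases eq_or_ne a (n * n + (2 * l.length + 1)) with rfl | ha
  · simp
  rw [Function.update_of_ne ha]
  unfold memo
  split_ifs with h1 h2
  · rfl
  · rfl
  · congr 1
    have : (a - n * n) / 2 ≠ l.length := by omega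
    rcases lt_or_gt_of_ne this with h | h
    · rw [List.getElem?_append_left h]
    · rw [List.getElem?_eq_none (by omega), List.getElem?_eq_none (by simp; omega)]

end

/-! ### Testing one set for domination and independence. -/

/-- The last binary digit. -/
def Expr.parity (e : Expr) : Expr := .sub e (.mul (.div e (.const 2)) (.const 2))

/-- The entry of the adjacency matrix for the vertices in registers 2 and 3. -/
def Expr.entry : Expr := .load (.add (.mul (.reg 2) (.reg 0)) (.reg 3))

/-- The list entry with the index `e`. -/
def Expr.item (e : Expr) : Expr :=
  .load (.add (.mul (.reg 0) (.reg 0)) (.add (.mul (.const 2) e) (.const 1)))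

/-- The address of the table entry of the set `e`. -/
def Expr.slot (e : Expr) : Expr := .add (.mul (.reg 0) (.reg 0)) (.mul (.const 2) e)

/-- Registers 2 and 3 hold the row `v` and the column `u`; registers 4 and 5 hold the code of the
set shifted by `v` and by `u` digits. The truncated expression `1 - ((u - v) + (v - u))` is the
indicator of `u = v`, which closes the neighbourhood counted in register 6. -/
def scanEntry : Prog := block [
  .set 6 (.add (.reg 6) (.mul (.parity (.reg 5))
    (.add .entry (.sub (.const 1) (.add (.sub (.reg 3) (.reg 2)) (.sub (.reg 2) (.reg 3))))))),
  .set 8 (.add (.reg 8) (.mul (.mul (.parity (.reg 5)) (.parity (.reg 4))) .entry)),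
  .set 5 (.div (.reg 5) (.const 2)),
  .set 3 (.add (.reg 3) (.const 1))]

def scanRow : Prog := block [
  .set 5 (.reg 9),
  .loop (.sub (.reg 0) (.reg 3)) scanEntry,
  -- Truncation makes the summand 1 exactly if the closed neighbourhood of the row vertex was not
  -- hit.
  .set 7 (.add (.reg 7) (.sub (.const 1) (.reg 6))),
  .set 3 (.const 0),
  .set 5 (.const 0),
  .set 6 (.const 0),
  .set 4 (.div (.reg 4) (.const 2)),
  .set 2 (.add (.reg 2) (.const 1))]

/-- Counts in register 7 the vertices that the set in register 9 does not dominate, and in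
register 8 its ordered pairs of adjacent members. -/
def scan : Prog := block [
  .set 4 (.reg 9),
  .set 7 (.const 0),
  .set 8 (.const 0),
  .loop (.sub (.reg 0) (.reg 2)) scanRow,
  .set 2 (.const 0),
  .set 4 (.const 0)]

/-- The number of members below `m` of `S` in the closed neighbourhood of `v`. -/
def hits (n : ℕ) (A : ℕ → ℕ) (S : Finset ℕ) (v m : ℕ) : ℕ :=
  ∑ u ∈ Finset.range m, (if u ∈ S then 1 else 0) * (A (v * n + u) + (1 - (u - v + (v - u))))

/-- The number of vertices below `m` that `S` does not dominate. -/
def missed (n : ℕ) (A : ℕ → ℕ) (S : Finset ℕ) (m : ℕ) : ℕ :=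
  ∑ v ∈ Finset.range m, (1 - hits n A S v n)

def rowClashes (n : ℕ) (A : ℕ → ℕ) (S : Finset ℕ) (v m : ℕ) : ℕ :=
  ∑ u ∈ Finset.range m,
    (if u ∈ S then 1 else 0) * (if v ∈ S then 1 else 0) * A (v * n + u)

/-- The number of ordered pairs of adjacent members of `S`, the first of them below `m`. -/
def clashes (n : ℕ) (A : ℕ → ℕ) (S : Finset ℕ) (m : ℕ) : ℕ :=
  ∑ v ∈ Finset.range m, rowClashes n A S v n

theorem hits_le {n : ℕ} {A : ℕ → ℕ} (hA : ∀ a, A a ≤ 1) (S : Finset ℕ) (v m : ℕ) :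
    hits n A S v m ≤ m * 2 := by
  rw [hits]
  refine (Finset.sum_le_card_nsmul _ _ 2 fun u _ => ?_).trans (by simp)
  have := hA (v * n + u)
  split_ifs <;> omega

theorem missed_le (n : ℕ) (A : ℕ → ℕ) (S : Finset ℕ) (m : ℕ) : missed n A S m ≤ m := by
  rw [missed]
  refine (Finset.sum_le_card_nsmul _ _ 1 fun u _ => ?_).trans (by simp)
  omega

theorem rowClashes_le {n : ℕ} {A : ℕ → ℕ} (hA : ∀ a, A a ≤ 1) (S : Finset ℕ) (v m : ℕ) :
    rowClashes n A S v m ≤ m := by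
  rw [rowClashes]
  refine (Finset.sum_le_card_nsmul _ _ 1 fun u _ => ?_).trans (by simp)
  have := hA (v * n + u)
  split_ifs <;> omega

theorem clashes_le {n : ℕ} {A : ℕ → ℕ} (hA : ∀ a, A a ≤ 1) (S : Finset ℕ) (m : ℕ) :
    clashes n A S m ≤ m * n := by
  rw [clashes]
  exact (Finset.sum_le_card_nsmul _ _ n fun u _ => rowClashes_le hA S _ _).trans (by simp)

theorem hits_succ (n : ℕ) (A : ℕ → ℕ) (S : Finset ℕ) (v m : ℕ) : hits n A S v (m + 1) =
    hits n A S v m + (if m ∈ S then 1 else 0) * (A (v * n + m) + (1 - (m - v + (v - m)))) :=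
  Finset.sum_range_succ _ _

theorem missed_succ (n : ℕ) (A : ℕ → ℕ) (S : Finset ℕ) (m : ℕ) :
    missed n A S (m + 1) = missed n A S m + (1 - hits n A S m n) :=
  Finset.sum_range_succ _ _

theorem rowClashes_succ (n : ℕ) (A : ℕ → ℕ) (S : Finset ℕ) (v m : ℕ) :
    rowClashes n A S v (m + 1) = rowClashes n A S v m +
      (if m ∈ S then 1 else 0) * (if v ∈ S then 1 else 0) * A (v * n + m) :=
  Finset.sum_range_succ _ _

theorem clashes_succ (n : ℕ) (A : ℕ → ℕ) (S : Finset ℕ) (m : ℕ) :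
    clashes n A S (m + 1) = clashes n A S m + rowClashes n A S m n :=
  Finset.sum_range_succ _ _

theorem div_two_pow_succ (x u : ℕ) : x / 2 ^ (u + 1) = x / 2 ^ u / 2 := by
  rw [Nat.div_div_eq_div_mul, pow_succ]

theorem ex_scanEntry_loop {n b : ℕ} {A : ℕ → ℕ} (hA : ∀ a, A a ≤ 1)
    (hb : 2 * n + n * n + 5 ≤ b) {k v y i j m len p bad viol : ℕ} {l : List (Finset ℕ)}
    {g : Finset ℕ → ℕ} {S : Finset ℕ} (hS : code S < b) (hv : v < n) (hviol : viol ≤ v * n) :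
    Ex b (.loop (.sub (.reg 0) (.reg 3)) scanEntry) (n * 6 + 1)
      (St [n, k, v, 0, code S / 2 ^ v, code S, 0, bad, viol, y, i, j, m, len, p] (memo n A l g))
      (St [n, k, v, n, code S / 2 ^ v, code S / 2 ^ n, hits n A S v n, bad,
        viol + rowClashes n A S v n, y, i, j, m, len, p] (memo n A l g)) := by
  have h := Ex.loop (b := b) (N := 5) (m := n) (P := scanEntry) (e := .sub (.reg 0) (.reg 3))
    (fun u => St [n, k, v, u, code S / 2 ^ v, code S / 2 ^ u, hits n A S v u, bad,
      viol + rowClashes n A S v u, y, i, j, m, len, p] (memo n A l g)) (by decide) ?_ ?_ ?_ ?_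
  · simpa [hits, rowClashes] using h
  · intro u hu
    simp
    omega
  · intro u hu
    simp
    omega
  · simp
  · intro u hu
    have h1 := hits_le (n := n) hA S v u
    have h2 := rowClashes_le (n := n) hA S v u
    have h3 : v * n ≤ n * n := Nat.mul_le_mul_right _ hv.le
    have h4 : code S / 2 ^ v ≤ code S := Nat.div_le_self _ _
    have h5 : code S / 2 ^ u ≤ code S := Nat.div_le_self _ _
    have h6 := hA (v * n + u)
    refine Ex.cons_set ?_ (by decide) (by simp) ?_
    · simp [Expr.parity, Expr.entry, hv, hu]
      omega
    refine Ex.cons_set ?_ (by decide) (by simp) ?_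
    · simp [Expr.parity, Expr.entry, hv, hu]
      omega
    refine Ex.cons_set ?_ (by decide) (by simp) ?_
    · simp
      omega
    refine Ex.cons_set ?_ (by decide) (by simp) (Ex.nil ?_)
    · simp
      omega
    simp [Expr.parity, Expr.entry, hv, hu, code_div_mod, hits_succ, rowClashes_succ,
      div_two_pow_succ, add_assoc]

theorem ex_scanRow_loop {n b : ℕ} {A : ℕ → ℕ} (hA : ∀ a, A a ≤ 1)
    (hb : 2 * n + n * n + 5 ≤ b) {k i j m len p : ℕ} {l : List (Finset ℕ)}
    {g : Finset ℕ → ℕ} {S : Finset ℕ} (hS : code S < b) :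
    Ex b (.loop (.sub (.reg 0) (.reg 2)) scanRow) (n * (n * 6 + 10) + 1)
      (St [n, k, 0, 0, code S, 0, 0, 0, 0, code S, i, j, m, len, p] (memo n A l g))
      (St [n, k, n, 0, code S / 2 ^ n, 0, 0, missed n A S n, clashes n A S n, code S,
        i, j, m, len, p] (memo n A l g)) := by
  have h := Ex.loop (b := b) (N := n * 6 + 9) (m := n) (P := scanRow)
    (e := .sub (.reg 0) (.reg 2))
    (fun v => St [n, k, v, 0, code S / 2 ^ v, 0, 0, missed n A S v, clashes n A S v, code S,
      i, j, m, len, p] (memo n A l g)) (by decide) ?_ ?_ ?_ ?_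
  · simpa [missed, clashes] using h
  · intro v hv
    simp
    omega
  · intro v hv
    simp
    omega
  · simp
  · intro v hv
    have h1 := hits_le (n := n) hA S v n
    have h2 := missed_le n A S v
    have h3 : v * n ≤ n * n := Nat.mul_le_mul_right _ hv.le
    have h4 : code S / 2 ^ v ≤ code S := Nat.div_le_self _ _
    refine Ex.mono (N := 7 + (n * 6 + 1) + 1) ?_ (by omega)
    refine Ex.cons_set ?_ (by decide) (by simp) ?_
    · simp
      omega
    refine Ex.cons (ex_scanEntry_loop hA hb hS hv (clashes_le hA S v)) ?_
    refine Ex.cons_set ?_ (by decide) (by simp) ?_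
    · simp
      omega
    refine Ex.cons_set ?_ (by decide) (by simp) ?_
    · simp
      omega
    refine Ex.cons_set ?_ (by decide) (by simp) ?_
    · simp
      omega
    refine Ex.cons_set ?_ (by decide) (by simp) ?_
    · simp
      omega
    refine Ex.cons_set ?_ (by decide) (by simp) ?_
    · simp
      omega
    refine Ex.cons_set ?_ (by decide) (by simp) (Ex.nil ?_)
    · simp
      omega
    simp [missed_succ, clashes_succ, div_two_pow_succ]

/-- The number of instructions that `scan` executes. -/
def scanTime (n : ℕ) : ℕ := n * (n * 6 + 10) + 7

theorem ex_scan {n b : ℕ} {A : ℕ → ℕ} (hA : ∀ a, A a ≤ 1)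
    (hb : 2 * n + n * n + 5 ≤ b) {k i j m len p bad viol : ℕ} {l : List (Finset ℕ)}
    {g : Finset ℕ → ℕ} {S : Finset ℕ} (hS : code S < b) :
    Ex b scan (scanTime n)
      (St [n, k, 0, 0, 0, 0, 0, bad, viol, code S, i, j, m, len, p] (memo n A l g))
      (St [n, k, 0, 0, 0, 0, 0, missed n A S n, clashes n A S n, code S,
        i, j, m, len, p] (memo n A l g)) := by
  refine Ex.mono (N := 3 + (n * (n * 6 + 10) + 1) + 3) ?_ (by rw [scanTime]; omega)
  refine Ex.cons_set ?_ (by decide) (by simp) ?_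
  · simp
    omega
  refine Ex.cons_set ?_ (by decide) (by simp) ?_
  · simp
    omega
  refine Ex.cons_set ?_ (by decide) (by simp) ?_
  · simp
    omega
  refine Ex.cons (ex_scanRow_loop hA hb hS) ?_
  refine Ex.cons_set ?_ (by decide) (by simp) ?_
  · simp
    omega
  refine Ex.cons_set ?_ (by decide) (by simp) (Ex.nil ?_)
  · simp
    omega
  simp

/-! ### Listing the dominating sets. -/

/-- The sets that arise by removing `i` from a member of `l` and that dominate all vertices. -/
def shrink (n : ℕ) (A : ℕ → ℕ) (i : ℕ) (l : List (Finset ℕ)) : List (Finset ℕ) :=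
  (l.map (·.erase i)).filter (fun S => missed n A S n = 0)

/-- The table with the entry 1 for the members of `l` without adjacent pairs. -/
def indepTable (n : ℕ) (A : ℕ → ℕ) (l : List (Finset ℕ)) (S : Finset ℕ) : ℕ :=
  if S ∈ l then 1 - clashes n A S n else 0

theorem update_indepTable (n : ℕ) (A : ℕ → ℕ) (l : List (Finset ℕ)) (S : Finset ℕ) :
    Function.update (indepTable n A l) S (1 - clashes n A S n) = indepTable n A (l ++ [S]) := by
  funext T
  rcases eq_or_ne T S with rfl | h
  · simp [indepTable]
  · simp [indepTable, h]

/-- Replaces register 9 by the list entry with the index in register 11 minus the number in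
register 14 and appends it to the list if it is a dominating set. -/
def grow : Prog := block [
  .set 9 (.sub (.item (.reg 11)) (.reg 14)),
  scan,
  .cond (.reg 7) .skip (block [
    .store (.add (.mul (.reg 0) (.reg 0)) (.add (.mul (.const 2) (.reg 13)) (.const 1))) (.reg 9),
    .store (.slot (.reg 9)) (.sub (.const 1) (.reg 8)),
    .set 13 (.add (.reg 13) (.const 1))]),
  .set 7 (.const 0),
  .set 8 (.const 0),
  .set 9 (.const 0),
  .set 11 (.add (.reg 11) (.const 1))]

def growRound : Prog := block [
  -- The list grows while it is read; freezing its length restricts the round to the old members.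
  .set 12 (.reg 13),
  .loop (.sub (.reg 12) (.reg 11)) grow,
  .set 12 (.const 0),
  .set 11 (.const 0),
  .set 14 (.mul (.const 2) (.reg 14)),
  .set 10 (.add (.reg 10) (.const 1))]

theorem shrink_take_succ {n : ℕ} {A : ℕ → ℕ} {i j : ℕ} {l : List (Finset ℕ)} {S : Finset ℕ}
    (hS : l[j]? = some S) : shrink n A i (l.take (j + 1)) = shrink n A i (l.take j) ++
      if missed n A (S.erase i) n = 0 then [S.erase i] else [] := by
  rw [List.take_add_one, hS]
  simp [shrink, List.filter_singleton]

theorem length_shrink_take_le (n : ℕ) (A : ℕ → ℕ) (i j : ℕ) (l : List (Finset ℕ)) :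
    (shrink n A i (l.take j)).length ≤ (shrink n A i l).length :=
  (((List.take_sublist j l).map _).filter _).length_le

theorem ex_grow_loop {n b : ℕ} {A : ℕ → ℕ} (hA : ∀ a, A a ≤ 1)
    (hb : 2 * n + n * n + 5 ≤ b) (hb' : 2 ^ n < b) {k i m : ℕ} {l : List (Finset ℕ)}
    (hl : ∀ S ∈ l, S ⊆ Finset.range n ∧ i ∈ S)
    (hlen : (l ++ shrink n A i l).length < b) :
    Ex b (.loop (.sub (.reg 12) (.reg 11)) grow) (l.length * (scanTime n + 12) + 1)
      (St [n, k, 0, 0, 0, 0, 0, 0, 0, 0, m, 0, l.length, l.length, 2 ^ i]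
        (memo n A l (indepTable n A l)))
      (St [n, k, 0, 0, 0, 0, 0, 0, 0, 0, m, l.length, l.length,
        (l ++ shrink n A i l).length, 2 ^ i]
        (memo n A (l ++ shrink n A i l) (indepTable n A (l ++ shrink n A i l)))) := by
  have h := Ex.loop (b := b) (N := scanTime n + 11) (m := l.length) (P := grow)
    (e := .sub (.reg 12) (.reg 11))
    (fun j => St [n, k, 0, 0, 0, 0, 0, 0, 0, 0, m, j, l.length,
        (l ++ shrink n A i (l.take j)).length, 2 ^ i]
        (memo n A (l ++ shrink n A i (l.take j)) (indepTable n A (l ++ shrink n A i (l.take j)))))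
    (by decide) ?_ ?_ ?_ ?_
  · simpa [shrink] using h
  · intro j hj
    simp at hlen ⊢
    omega
  · intro j hj
    simp
    omega
  · simp
  · intro j hj
    obtain ⟨S, hS⟩ : ∃ S, l[j]? = some S := ⟨_, List.getElem?_eq_getElem hj⟩
    have hS' : (l ++ shrink n A i (l.take j))[j]? = some S := by
      rw [List.getElem?_append_left hj, hS]
    obtain ⟨hSn, hiS⟩ := hl S (List.mem_of_getElem? hS)
    have hin : i < n := Finset.mem_range.1 (hSn hiS)
    have h1 := code_lt hSn
    have h2 : code (S.erase i) < 2 ^ n := code_lt ((Finset.erase_subset _ _).trans hSn)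
    have h3 : 2 ^ i < 2 ^ n := Nat.pow_lt_pow_right (by norm_num) hin
    have h4 := length_shrink_take_le n A i j l
    have h5 := missed_le n A (S.erase i) n
    have h6 := clashes_le (n := n) hA (S.erase i) n
    rw [List.length_append] at hlen
    refine Ex.mono (N := 1 + 4 + (3 + 1 + 1) + scanTime n + 1) ?_ (by omega)
    generalize hL : l ++ shrink n A i (l.take j) = L at *
    have hL' : L.length < b := by rw [← hL, List.length_append]; omega
    refine Ex.cons_set ?_ (by decide) (by simp) ?_
    · simp [Expr.item, hS']
      omega
    have hsub : code S - 2 ^ i = code (S.erase i) := code_erase hiS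
    simp only [Expr.item, Expr.val, St_reg, St_mem, List.getD_cons_succ, List.getD_cons_zero,
      memo_list, hS', Option.getD_some, hsub, List.set_cons_succ, List.set_cons_zero]
    refine Ex.cons (ex_scan hA hb (by omega)) ?_
    refine Ex.cons (s' := St [n, k, 0, 0, 0, 0, 0, missed n A (S.erase i) n,
        clashes n A (S.erase i) n, code (S.erase i), m, j, l.length,
        (l ++ shrink n A i (l.take (j + 1))).length, 2 ^ i]
        (memo n A (l ++ shrink n A i (l.take (j + 1)))
          (indepTable n A (l ++ shrink n A i (l.take (j + 1)))))) ?_ ?_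
    · rw [shrink_take_succ hS, ← List.append_assoc, hL]
      by_cases h0 : missed n A (S.erase i) n = 0
      · refine Ex.cond_false (by simp; omega) (by decide) (by simpa using h0) ?_
        rw [if_pos h0]
        refine Ex.cons_store ?_ ?_ (by decide) (by decide) ?_
        · simp
          omega
        · simp
          omega
        refine Ex.cons_store ?_ ?_ (by decide) (by decide) ?_
        · simp [Expr.slot]
          omega
        · simp
          omega
        refine Ex.cons_set ?_ (by decide) (by simp) (Ex.nil ?_)
        · simp
          omega
        simp [Expr.slot, update_indepTable]
      · refine Ex.cond_true (by simp; omega) (by decide) (by simpa using h0) ?_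
        rw [if_neg h0, List.append_nil]
        exact Ex.skip rfl
    refine Ex.cons_set ?_ (by decide) (by simp) ?_
    · simp
      omega
    refine Ex.cons_set ?_ (by decide) (by simp) ?_
    · simp
      omega
    refine Ex.cons_set ?_ (by decide) (by simp) ?_
    · simp
      omega
    refine Ex.cons_set ?_ (by decide) (by simp) (Ex.nil ?_)
    · simp
      omega
    simp

/-- The dominating sets that contain all vertices from `i` on. -/
def dominators (n : ℕ) (A : ℕ → ℕ) : ℕ → List (Finset ℕ)
  | 0 => [Finset.range n]
  | i + 1 => dominators n A i ++ shrink n A i (dominators n A i)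

theorem missed_eq_zero {n : ℕ} {A : ℕ → ℕ} {S : Finset ℕ} :
    missed n A S n = 0 ↔ ∀ v < n, ∃ u < n, u ∈ S ∧ (u = v ∨ A (v * n + u) ≠ 0) := by
  simp only [missed, hits, Finset.sum_eq_zero_iff, Finset.mem_range, Nat.sub_eq_zero_iff_le,
    Nat.one_le_iff_ne_zero, ne_eq, not_forall, mul_eq_zero, not_or, exists_prop]
  refine forall₂_congr fun v _ => exists_congr fun u => and_congr_right fun _ => ?_
  simp only [ite_eq_right_iff, one_ne_zero, imp_false, not_not]
  refine and_congr_right fun _ => ?_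
  omega

theorem clashes_eq_zero {n : ℕ} {A : ℕ → ℕ} {S : Finset ℕ} :
    clashes n A S n = 0 ↔ ∀ v < n, ∀ u < n, u ∈ S → v ∈ S → A (v * n + u) = 0 := by
  simp only [clashes, rowClashes, Finset.sum_eq_zero_iff, Finset.mem_range, mul_eq_zero]
  refine forall₂_congr fun v _ => forall₂_congr fun u _ => ?_
  by_cases hu : u ∈ S <;> by_cases hv : v ∈ S <;> simp [hu, hv]

theorem missed_eq_zero_of_subset {n : ℕ} {A : ℕ → ℕ} {S T : Finset ℕ} (h : S ⊆ T)
    (hS : missed n A S n = 0) : missed n A T n = 0 := by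
  rw [missed_eq_zero] at *
  intro v hv
  obtain ⟨u, hu, huS, h'⟩ := hS v hv
  exact ⟨u, hu, h huS, h'⟩

/-- If `S` is dominating and `i ∉ S`, then `insert i S` is dominating too. It was listed earlier, so
`S` arises from it by deleting `i`. -/
theorem mem_dominators {n : ℕ} {A : ℕ → ℕ} {i : ℕ} (hi : i ≤ n) {S : Finset ℕ} :
    S ∈ dominators n A i ↔
      S ⊆ Finset.range n ∧ missed n A S n = 0 ∧ ∀ v < n, i ≤ v → v ∈ S := by
  induction i generalizing S with
  | zero =>
    simp only [dominators, List.mem_singleton]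
    constructor
    · rintro rfl
      refine ⟨subset_rfl, missed_eq_zero.2 fun v hv => ⟨v, hv, ?_, .inl rfl⟩, ?_⟩
      · simpa using hv
      · simp
    · rintro ⟨h1, -, h3⟩
      exact h1.antisymm fun v hv => h3 v (Finset.mem_range.1 hv) (Nat.zero_le _)
  | succ i ih =>
    simp only [dominators, List.mem_append, shrink, List.mem_filter, List.mem_map,
      ih (by omega), decide_eq_true_eq]
    constructor
    · rintro (⟨h1, h2, h3⟩ | ⟨⟨T, ⟨h1, h2, h3⟩, rfl⟩, h4⟩)
      · exact ⟨h1, h2, fun v hv hiv => h3 v hv (by omega)⟩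
      · exact ⟨(Finset.erase_subset _ _).trans h1, h4, fun v hv hiv =>
          Finset.mem_erase.2 ⟨by omega, h3 v hv (by omega)⟩⟩
    · rintro ⟨h1, h2, h3⟩
      by_cases hS : i ∈ S
      · refine .inl ⟨h1, h2, fun v hv hiv => ?_⟩
        rcases hiv.eq_or_lt with rfl | h
        · exact hS
        · exact h3 v hv h
      · refine .inr ⟨⟨insert i S, ⟨?_, ?_, ?_⟩, Finset.erase_insert hS⟩, h2⟩
        · exact Finset.insert_subset (Finset.mem_range.2 (by omega)) h1
        · exact missed_eq_zero_of_subset (Finset.subset_insert _ _) h2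
        · intro v hv hiv
          rcases hiv.eq_or_lt with rfl | h
          · exact Finset.mem_insert_self _ _
          · exact Finset.mem_insert_of_mem (h3 v hv h)

/-- The old members contain `i` and the new ones do not, and erasing `i` is injective on sets that
contain it. Thus the list length is the number of dominating sets, and a sweep treats no table entry
twice. -/
theorem nodup_dominators {n : ℕ} {A : ℕ → ℕ} {i : ℕ} (hi : i ≤ n) :
    (dominators n A i).Nodup := by
  induction i with
  | zero => simp [dominators]
  | succ i ih =>
    have hmem : ∀ S ∈ dominators n A i, i ∈ S := fun S hS =>
      ((mem_dominators (by omega)).1 hS).2.2 i (by omega) le_rfl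
    refine List.nodup_append.2 ⟨ih (by omega), ?_, ?_⟩
    · refine List.Nodup.filter _ (List.Nodup.map_on ?_ (ih (by omega)))
      intro S hS T hT h
      rw [← Finset.insert_erase (hmem S hS), h, Finset.insert_erase (hmem T hT)]
    · rintro S hS T hT rfl
      simp only [shrink, List.mem_filter, List.mem_map] at hT
      obtain ⟨⟨U, -, rfl⟩, -⟩ := hT
      simpa using hmem _ hS

theorem length_dominators_mono (n : ℕ) (A : ℕ → ℕ) {i j : ℕ} (h : i ≤ j) :
    (dominators n A i).length ≤ (dominators n A j).length := by
  induction j, h using Nat.le_induction with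
  | base => exact le_rfl
  | succ j _ ih =>
    rw [dominators, List.length_append]
    omega

theorem length_dominators_le (n : ℕ) (A : ℕ → ℕ) : (dominators n A n).length ≤ 2 ^ n := by
  classical
  rw [← List.toFinset_card_of_nodup (nodup_dominators le_rfl), ← Finset.card_range n,
    ← Finset.card_powerset, Finset.card_range]
  refine Finset.card_le_card fun S hS => ?_
  rw [List.mem_toFinset, mem_dominators le_rfl] at hS
  exact Finset.mem_powerset.2 hS.1

theorem length_dominators_pos (n : ℕ) (A : ℕ → ℕ) : 0 < (dominators n A n).length :=
  length_dominators_mono n A (Nat.zero_le n)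

theorem ex_growRound_loop {n b : ℕ} {A : ℕ → ℕ} (hA : ∀ a, A a ≤ 1)
    (hb : 2 * n + n * n + 5 ≤ b) (hb' : 2 ^ n < b) {k : ℕ} :
    Ex b (.loop (.sub (.reg 0) (.reg 10)) growRound)
      (n * ((dominators n A n).length * (scanTime n + 12) + 8) + 1)
      (St [n, k, 0, 0, 0, 0, 0, 0, 0, 0, 0, 0, 0, 1, 1]
        (memo n A [Finset.range n] (indepTable n A [Finset.range n])))
      (St [n, k, 0, 0, 0, 0, 0, 0, 0, 0, n, 0, 0, (dominators n A n).length, 2 ^ n]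
        (memo n A (dominators n A n) (indepTable n A (dominators n A n)))) := by
  have hD := length_dominators_le n A
  have h := Ex.loop (b := b) (N := (dominators n A n).length * (scanTime n + 12) + 7) (m := n)
    (P := growRound) (e := .sub (.reg 0) (.reg 10))
    (fun i => St [n, k, 0, 0, 0, 0, 0, 0, 0, 0, i, 0, 0, (dominators n A i).length, 2 ^ i]
        (memo n A (dominators n A i) (indepTable n A (dominators n A i))))
    (by decide) ?_ ?_ ?_ ?_
  · simpa [dominators] using h
  · intro j hj
    simp
    omega
  · intro j hj
    simp
    omega
  · simp
  · intro i hi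
    have h1 := length_dominators_mono n A hi
    have h2 := length_dominators_mono n A hi.le
    have h3 : 2 ^ i < 2 ^ n := Nat.pow_lt_pow_right (by norm_num) hi
    -- The list never shrinks, so its final length bounds the work of every round.
    have h4 : (dominators n A i).length * (scanTime n + 12) ≤
      (dominators n A n).length * (scanTime n + 12) := Nat.mul_le_mul_right _ h2
    refine Ex.mono (N := 5 + ((dominators n A i).length * (scanTime n + 12) + 1) + 1) ?_
      (by omega)
    refine Ex.cons_set ?_ (by decide) (by simp) ?_
    · simp
      omega
    refine Ex.cons (ex_grow_loop hA hb hb' ?_ ?_) ?_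
    · intro S hS
      have := (mem_dominators hi.le).1 hS
      exact ⟨this.1, this.2.2 i hi le_rfl⟩
    · exact h1.trans_lt (by omega)
    refine Ex.cons_set ?_ (by decide) (by simp) ?_
    · simp
      omega
    refine Ex.cons_set ?_ (by decide) (by simp) ?_
    · simp
      omega
    refine Ex.cons_set ?_ (by decide) (by simp) ?_
    · simp
      omega
    refine Ex.cons_set ?_ (by decide) (by simp) (Ex.nil ?_)
    · simp
      omega
    simp [dominators, pow_succ, mul_comm]

/-! ### Transforms in place over the listed sets, and pointwise powers. -/

/-- Replaces the table entry of the set `Y` with the index in register 11 by the value of `op` at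
the entries of `Y` and of `Y` without `i`, if `i` is a member of `Y` and register 14 holds
`2 ^ i`. -/
def sweep (op : Expr → Expr → Expr) : Prog := block [
  .set 9 (.item (.reg 11)),
  .cond (.parity (.div (.reg 9) (.reg 14)))
    (block [.store (.slot (.reg 9))
      (op (.load (.slot (.reg 9))) (.load (.slot (.sub (.reg 9) (.reg 14)))))])
    .skip,
  .set 9 (.const 0),
  .set 11 (.add (.reg 11) (.const 1))]

def sweepRound (op : Expr → Expr → Expr) : Prog := block [
  .loop (.sub (.reg 13) (.reg 11)) (sweep op),
  .set 11 (.const 0),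
  .set 14 (.mul (.const 2) (.reg 14)),
  .set 10 (.add (.reg 10) (.const 1))]

def sweeps (op : Expr → Expr → Expr) : Prog := block [
  .loop (.sub (.reg 0) (.reg 10)) (sweepRound op),
  .set 10 (.const 0),
  .set 14 (.const 1)]

/-- `op` computes the binary operation `o`. -/
structure Computes (op : Expr → Expr → Expr) (o : ℕ → ℕ → ℕ) : Prop where
  val : ∀ s a c, (op a c).val s = o (a.val s) (c.val s)
  ok : ∀ b s a c, a.Ok b s → c.Ok b s → (op a c).Ok b s
  nodes : ∀ a c, (op a c).nodes = a.nodes + c.nodes + 1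

theorem computes_add : Computes .add (· + ·) :=
  ⟨fun _ _ _ => rfl, fun _ _ _ _ h h' => ⟨h, h'⟩, fun _ _ => rfl⟩

theorem computes_sub : Computes .sub (· - ·) :=
  ⟨fun _ _ _ => rfl, fun _ _ _ _ h h' => ⟨h, h'⟩, fun _ _ => rfl⟩

def sweepTable (o : ℕ → ℕ → ℕ) (i : ℕ) (l : List (Finset ℕ)) (g : Finset ℕ → ℕ)
    (S : Finset ℕ) : ℕ :=
  if S ∈ l ∧ i ∈ S then o (g S) (g (S.erase i)) else g S

theorem sweepTable_nil (o : ℕ → ℕ → ℕ) (i : ℕ) (g : Finset ℕ → ℕ) : sweepTable o i [] g = g := by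
  funext S
  simp [sweepTable]

/-- Working in place is harmless: the sweep for `i` changes only entries of sets that contain `i`,
and it reads the entry of `S` itself, still untouched because the list has no repetitions, and that
of `S.erase i`, which it never changes. -/
theorem sweepTable_take_succ {o : ℕ → ℕ → ℕ} {i j : ℕ} {l : List (Finset ℕ)} {S : Finset ℕ}
    (hl : l.Nodup) (hS : l[j]? = some S) (g : Finset ℕ → ℕ) :
    sweepTable o i (l.take (j + 1)) g = if i ∈ S then
      Function.update (sweepTable o i (l.take j) g) S (o (sweepTable o i (l.take j) g S)
        (sweepTable o i (l.take j) g (S.erase i))) else sweepTable o i (l.take j) g := by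
  have h1 : l.take (j + 1) = l.take j ++ [S] := by rw [List.take_add_one, hS]; rfl
  have h2 : S ∉ l.take j := by
    have := h1 ▸ hl.sublist (List.take_sublist (j + 1) l)
    rw [List.nodup_append] at this
    exact fun h => this.2.2 S h S (by simp) rfl
  funext T
  rw [h1]
  by_cases hi : i ∈ S
  · rw [if_pos hi]
    rcases eq_or_ne T S with rfl | hT
    · simp [sweepTable, hi, h2]
    · simp [sweepTable, hT]
  · rw [if_neg hi]
    rcases eq_or_ne T S with rfl | hT
    · simp [sweepTable, hi]
    · simp [sweepTable, hT]

section

variable {n b : ℕ} {A : ℕ → ℕ} {l : List (Finset ℕ)}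

theorem ex_sweep_loop {op : Expr → Expr → Expr} {o : ℕ → ℕ → ℕ} (hop : Computes op o)
    (hb : 2 * n + n * n + 5 ≤ b) (hb' : 2 ^ n < b) {k i : ℕ} (hi : i < n)
    {g : Finset ℕ → ℕ} (hl : l.Nodup) (hlen : l.length < b)
    (hln : ∀ S ∈ l, S ⊆ Finset.range n) (hg : ∀ S, g S < b)
    (hg' : ∀ S, sweepTable o i l g S < b) :
    Ex b (.loop (.sub (.reg 13) (.reg 11)) (sweep op)) (l.length * 8 + 1)
      (St [n, k, 0, 0, 0, 0, 0, 0, 0, 0, i, 0, 0, l.length, 2 ^ i] (memo n A l g))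
      (St [n, k, 0, 0, 0, 0, 0, 0, 0, 0, i, l.length, 0, l.length, 2 ^ i]
        (memo n A l (sweepTable o i l g))) := by
  have h := Ex.loop (b := b) (N := 7) (m := l.length) (P := sweep op)
    (e := .sub (.reg 13) (.reg 11))
    (fun j => St [n, k, 0, 0, 0, 0, 0, 0, 0, 0, i, j, 0, l.length, 2 ^ i]
        (memo n A l (sweepTable o i (l.take j) g)))
    (by decide) ?_ ?_ ?_ ?_
  · simpa [sweepTable_nil] using h
  · intro j hj
    simp
    omega
  · intro j hj
    simp
    omega
  · simp
  · intro j hj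
    obtain ⟨S, hS⟩ : ∃ S, l[j]? = some S := ⟨_, List.getElem?_eq_getElem hj⟩
    have hSn := hln S (List.mem_of_getElem? hS)
    have h1 := code_lt hSn
    have h2 : 2 ^ i < 2 ^ n := Nat.pow_lt_pow_right (by norm_num) hi
    -- Halfway through the sweep each entry has either its initial or its final value.
    have hG : ∀ T, sweepTable o i (l.take j) g T < b := by
      intro T
      have h3 := hg T
      have h4 := hg' T
      unfold sweepTable at h4 ⊢
      by_cases h5 : T ∈ l.take j
      · simp only [h5, List.mem_of_mem_take h5] at h4 ⊢
        exact h4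
      · simpa [h5] using h3
    rw [sweepTable_take_succ hl hS]
    generalize sweepTable o i (l.take j) g = G at *
    refine Ex.cons_set (N := 1 + 1 + 1 + 2 + 1) ?_ (by decide) (by simp) ?_
    · simp [Expr.item, hS]
      omega
    simp only [Expr.item, Expr.val, St_reg, St_mem, List.getD_cons_succ, List.getD_cons_zero,
      memo_list, hS, Option.getD_some, List.set_cons_succ, List.set_cons_zero]
    refine Ex.cons (s' := St [n, k, 0, 0, 0, 0, 0, 0, 0, code S, i, j, 0, l.length, 2 ^ i]
      (memo n A l (if i ∈ S then Function.update G S (o (G S) (G (S.erase i))) else G)))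
      (N := 2 + 1) ?_ ?_
    · by_cases hiS : i ∈ S
      · have hsub : code S - 2 ^ i = code (S.erase i) := code_erase hiS
        refine Ex.cond_true (by simp [Expr.parity]; omega) (by decide)
          (by simp [Expr.parity, code_div_mod, hiS]) ?_
        rw [if_pos hiS]
        refine Ex.cons_store ?_ (hop.ok _ _ _ _ ?_ ?_) (by decide) ?_ (Ex.nil ?_)
        · simp [Expr.slot]
          omega
        · simp [Expr.slot, hG]
          omega
        · simp [Expr.slot, hG, hsub]
          omega
        · rw [hop.nodes]
          decide
        · simp [Expr.slot, hop.val, hsub]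
      · refine Ex.cond_false (by simp [Expr.parity]; omega) (by decide)
          (by simp [Expr.parity, code_div_mod, hiS]) ?_
        rw [if_neg hiS]
        exact Ex.skip rfl
    refine Ex.cons_set ?_ (by decide) (by simp) ?_
    · simp
      omega
    refine Ex.cons_set ?_ (by decide) (by simp) (Ex.nil ?_)
    · simp
      omega
    simp

theorem ex_sweeps {op : Expr → Expr → Expr} {o : ℕ → ℕ → ℕ} (hop : Computes op o)
    (hb : 2 * n + n * n + 5 ≤ b) (hb' : 2 ^ n < b) {k : ℕ}
    (hl : l.Nodup) (hlen : l.length < b) (hln : ∀ S ∈ l, S ⊆ Finset.range n)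
    {g : ℕ → Finset ℕ → ℕ} (hg : ∀ i ≤ n, ∀ S, g i S < b)
    (hsucc : ∀ i < n, g (i + 1) = sweepTable o i l (g i)) :
    Ex b (sweeps op) (n * (l.length * 8 + 6) + 4)
      (St [n, k, 0, 0, 0, 0, 0, 0, 0, 0, 0, 0, 0, l.length, 1] (memo n A l (g 0)))
      (St [n, k, 0, 0, 0, 0, 0, 0, 0, 0, 0, 0, 0, l.length, 1] (memo n A l (g n))) := by
  have h := Ex.loop (b := b) (N := l.length * 8 + 5) (m := n) (P := sweepRound op)
    (e := .sub (.reg 0) (.reg 10))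
    (fun i => St [n, k, 0, 0, 0, 0, 0, 0, 0, 0, i, 0, 0, l.length, 2 ^ i] (memo n A l (g i)))
    (by decide) ?_ ?_ ?_ ?_
  · refine Ex.mono (N := 3 + _) ?_ (le_of_eq (add_comm _ _))
    refine Ex.cons h ?_
    refine Ex.cons_set ?_ (by decide) (by simp) ?_
    · simp
      omega
    refine Ex.cons_set ?_ (by decide) (by simp) (Ex.nil ?_)
    · simp
      omega
    simp
  · intro j hj
    simp
    omega
  · intro j hj
    simp
    omega
  · simp
  · intro i hi
    have h3 : 2 ^ i < 2 ^ n := Nat.pow_lt_pow_right (by norm_num) hi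
    refine Ex.mono (N := 4 + (l.length * 8 + 1)) ?_ (by omega)
    have hs := hsucc i hi
    refine Ex.cons (ex_sweep_loop hop hb hb' hi hl hlen hln (hg i hi.le)
      (hs ▸ hg (i + 1) hi)) ?_
    refine Ex.cons_set ?_ (by decide) (by simp) ?_
    · simp
      omega
    refine Ex.cons_set ?_ (by decide) (by simp) ?_
    · simp
      omega
    refine Ex.cons_set ?_ (by decide) (by simp) (Ex.nil ?_)
    · simp
      omega
    simp [hs, pow_succ, mul_comm]

end

def powerStep : Prog := block [
  .set 12 (.mul (.reg 12) (.load (.slot (.reg 9)))),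
  .set 10 (.add (.reg 10) (.const 1))]

def power : Prog := block [
  .set 9 (.item (.reg 11)),
  .set 12 (.const 1),
  .loop (.sub (.reg 1) (.reg 10)) powerStep,
  .store (.slot (.reg 9)) (.reg 12),
  .set 9 (.const 0),
  .set 10 (.const 0),
  .set 12 (.const 0),
  .set 11 (.add (.reg 11) (.const 1))]

/-- Raises the table entries of all members of the list to the power in register 1. -/
def powers : Prog := block [
  .loop (.sub (.reg 13) (.reg 11)) power,
  .set 11 (.const 0)]

def powerTable (k : ℕ) (l : List (Finset ℕ)) (g : Finset ℕ → ℕ) (S : Finset ℕ) : ℕ :=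
  if S ∈ l then g S ^ k else g S

theorem powerTable_nil (k : ℕ) (g : Finset ℕ → ℕ) : powerTable k [] g = g := by
  funext S
  simp [powerTable]

theorem powerTable_take_succ {k j : ℕ} {l : List (Finset ℕ)} {S : Finset ℕ}
    (hS : l[j]? = some S) (g : Finset ℕ → ℕ) : powerTable k (l.take (j + 1)) g =
      Function.update (powerTable k (l.take j) g) S (g S ^ k) := by
  have h1 : l.take (j + 1) = l.take j ++ [S] := by rw [List.take_add_one, hS]; rfl
  funext T
  rw [h1]
  rcases eq_or_ne T S with rfl | hT
  · simp [powerTable]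
  · simp [powerTable, hT]

section

variable {n b k : ℕ} {A : ℕ → ℕ} {l : List (Finset ℕ)} {g : Finset ℕ → ℕ}

theorem ex_powerStep_loop (hb : 2 * n + n * n + 5 ≤ b) {S : Finset ℕ} {j len : ℕ}
    (hS : code S < b) (hk : k < b) (hg1 : g S < b) (hg : ∀ t ≤ k, g S ^ t < b) :
    Ex b (.loop (.sub (.reg 1) (.reg 10)) powerStep) (k * 4 + 1)
      (St [n, k, 0, 0, 0, 0, 0, 0, 0, code S, 0, j, 1, len, 1] (memo n A l g))
      (St [n, k, 0, 0, 0, 0, 0, 0, 0, code S, k, j, g S ^ k, len, 1] (memo n A l g)) := by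
  have h := Ex.loop (b := b) (N := 3) (m := k) (P := powerStep)
    (e := .sub (.reg 1) (.reg 10))
    (fun t => St [n, k, 0, 0, 0, 0, 0, 0, 0, code S, t, j, g S ^ t, len, 1] (memo n A l g))
    (by decide) ?_ ?_ ?_ ?_
  · simpa using h
  · intro t ht
    simp
    omega
  · intro t ht
    simp
    omega
  · simp
  · intro t ht
    have := hg t ht.le
    refine Ex.cons_set ?_ (by decide) (by simp) ?_
    · simp [Expr.slot, hg1]
      omega
    refine Ex.cons_set ?_ (by decide) (by simp) (Ex.nil ?_)
    · simp
      omega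
    simp [Expr.slot, pow_succ]

theorem ex_powers (hb : 2 * n + n * n + 5 ≤ b) (hb' : 2 ^ n < b) (hk : k < b) (hl : l.Nodup)
    (hlen : l.length < b) (hln : ∀ S ∈ l, S ⊆ Finset.range n) (hg1 : ∀ S, g S < b)
    (hg : ∀ S, ∀ t ≤ k, g S ^ t < b) :
    Ex b powers (l.length * (k * 4 + 10) + 3)
      (St [n, k, 0, 0, 0, 0, 0, 0, 0, 0, 0, 0, 0, l.length, 1] (memo n A l g))
      (St [n, k, 0, 0, 0, 0, 0, 0, 0, 0, 0, 0, 0, l.length, 1]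
        (memo n A l (powerTable k l g))) := by
  have h := Ex.loop (b := b) (N := k * 4 + 9) (m := l.length) (P := power)
    (e := .sub (.reg 13) (.reg 11))
    (fun j => St [n, k, 0, 0, 0, 0, 0, 0, 0, 0, 0, j, 0, l.length, 1]
      (memo n A l (powerTable k (l.take j) g)))
    (by decide) ?_ ?_ ?_ ?_
  · refine Ex.mono (N := 2 + _) ?_ (le_of_eq (add_comm _ _))
    refine Ex.cons (s' := St [n, k, 0, 0, 0, 0, 0, 0, 0, 0, 0, l.length, 0, l.length, 1]
      (memo n A l (powerTable k l g))) (by simpa [powerTable_nil, add_assoc] using h) ?_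
    refine Ex.cons_set ?_ (by decide) (by simp) (Ex.nil ?_)
    · simp
      omega
    simp
  · intro j hj
    simp
    omega
  · intro j hj
    simp
    omega
  · simp
  · intro j hj
    obtain ⟨S, hS⟩ : ∃ S, l[j]? = some S := ⟨_, List.getElem?_eq_getElem hj⟩
    have h1 := code_lt (hln S (List.mem_of_getElem? hS))
    have hgk := hg S k le_rfl
    -- Without repetitions in the list, `S` has not been raised to the power before.
    have hGS : powerTable k (l.take j) g S = g S := by
      have h2 : l.take (j + 1) = l.take j ++ [S] := by rw [List.take_add_one, hS]; rfl
      have h3 := h2 ▸ hl.sublist (List.take_sublist (j + 1) l)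
      rw [List.nodup_append] at h3
      exact if_neg fun h => h3.2.2 S h S (by simp) rfl
    rw [powerTable_take_succ hS]
    generalize powerTable k (l.take j) g = G at *
    refine Ex.mono (N := 6 + (k * 4 + 1) + 1 + 1) ?_ (by omega)
    refine Ex.cons_set ?_ (by decide) (by simp) ?_
    · simp [Expr.item, hS]
      omega
    simp only [Expr.item, Expr.val, St_reg, St_mem, List.getD_cons_succ, List.getD_cons_zero,
      memo_list, hS, Option.getD_some, List.set_cons_succ, List.set_cons_zero]
    refine Ex.cons_set ?_ (by decide) (by simp) ?_
    · simp
      omega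
    refine Ex.cons (ex_powerStep_loop hb (by omega) hk (hGS ▸ hg1 S) (hGS ▸ hg S)) ?_
    rw [hGS]
    refine Ex.cons_store ?_ ?_ (by decide) (by decide) ?_
    · simp [Expr.slot]
      omega
    · simp
      omega
    refine Ex.cons_set ?_ (by decide) (by simp) ?_
    · simp
      omega
    refine Ex.cons_set ?_ (by decide) (by simp) ?_
    · simp
      omega
    refine Ex.cons_set ?_ (by decide) (by simp) ?_
    · simp
      omega
    refine Ex.cons_set ?_ (by decide) (by simp) (Ex.nil ?_)
    · simp
      omega
    simp [Expr.slot]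

end

/-! ### Counting kernels and coverings by trimmed transforms. -/

variable (n : ℕ) (A : ℕ → ℕ)

/-- The independent dominating sets, that is, the maximal independent sets. -/
def kernels : Finset (Finset ℕ) :=
  (dominators n A n).toFinset.filter fun X => clashes n A X n = 0

/-- The number of maximal independent subsets of `S` that agree with `S` from `i` on. -/
def zeta (i : ℕ) (S : Finset ℕ) : ℕ :=
  ((kernels n A).filter fun X => X ⊆ S ∧ ∀ v ∈ S, i ≤ v → v ∈ X).card

/-- The number of `k`-tuples of maximal independent subsets of `S` that cover the part of `S`
below `i` and no vertex outside the graph. -/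
def covers (k i : ℕ) (S : Finset ℕ) : ℕ :=
  ((Fintype.piFinset fun _ : Fin k => kernels n A).filter fun t =>
    -- Kernels contain no `v ≥ n`, so the clause `n ≤ v` makes the count 0 on sets that leave the
    -- graph, where the table is 0 as well.
    (∀ j, t j ⊆ S) ∧ ∀ v ∈ S, v < i ∨ n ≤ v → ∃ j, v ∈ t j).card

variable {n A}

theorem mem_kernels {X : Finset ℕ} : X ∈ kernels n A ↔
    X ⊆ Finset.range n ∧ missed n A X n = 0 ∧ clashes n A X n = 0 := by
  rw [kernels, Finset.mem_filter, List.mem_toFinset, mem_dominators le_rfl]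
  constructor
  · exact fun h => ⟨h.1.1, h.1.2.1, h.2⟩
  · exact fun h => ⟨⟨h.1, h.2.1, fun v hv hv' => absurd hv hv'.not_gt⟩, h.2.2⟩

/-- This is what permits trimming: a set that is not listed contains no kernel, so its counts are 0
and need no update. -/
theorem mem_dominators_of_kernel {X S : Finset ℕ} (hX : X ∈ kernels n A) (hXS : X ⊆ S)
    (hS : S ⊆ Finset.range n) : S ∈ dominators n A n :=
  (mem_dominators le_rfl).2 ⟨hS, missed_eq_zero_of_subset hXS (mem_kernels.1 hX).2.1,
    fun _ hv hv' => absurd hv hv'.not_gt⟩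

theorem zeta_zero : zeta n A 0 = indepTable n A (dominators n A n) := by
  funext S
  have h : ((kernels n A).filter fun X => X ⊆ S ∧ ∀ v ∈ S, 0 ≤ v → v ∈ X) =
      (kernels n A).filter fun X => S = X := by
    refine Finset.filter_congr fun X _ => ?_
    constructor
    · exact fun h => subset_antisymm (fun v hv => h.2 v hv (Nat.zero_le _)) h.1
    · rintro rfl
      exact ⟨subset_rfl, fun v hv _ => hv⟩
  rw [zeta, h, Finset.filter_eq, indepTable]
  by_cases h1 : S ∈ dominators n A n <;> by_cases h2 : clashes n A S n = 0 <;>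
    simp [kernels, h1, h2]
  omega

/-- If `i ∈ S`, the kernels counted on the left that contain `i` are those counted for `S` before,
and the others are those counted for `S.erase i`. For `S` not listed, no kernel qualifies; for `i ∉
S`, the condition does not change. -/
theorem zeta_succ {i : ℕ} (hi : i < n) :
    zeta n A (i + 1) = sweepTable (· + ·) i (dominators n A n) (zeta n A i) := by
  funext S
  unfold sweepTable
  split_ifs with h
  · simp only [zeta]
    rw [← Finset.card_filter_add_card_filter_not (fun X : Finset ℕ => i ∈ X),
      Finset.filter_filter, Finset.filter_filter]
    congr 2 <;> refine Finset.filter_congr fun X _ => ?_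
    · constructor
      · rintro ⟨⟨h1, h2⟩, h3⟩
        refine ⟨h1, fun v hv hiv => ?_⟩
        rcases hiv.eq_or_lt with rfl | hlt
        exacts [h3, h2 v hv hlt]
      · rintro ⟨h1, h2⟩
        exact ⟨⟨h1, fun v hv hiv => h2 v hv (by omega)⟩, h2 i h.2 le_rfl⟩
    · constructor
      · rintro ⟨⟨h1, h2⟩, h3⟩
        refine ⟨Finset.subset_erase.2 ⟨h1, h3⟩, fun v hv hiv => ?_⟩
        rw [Finset.mem_erase] at hv
        exact h2 v hv.2 (by omega)
      · rintro ⟨h1, h2⟩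
        rw [Finset.subset_erase] at h1
        exact ⟨⟨h1.1, fun v hv hiv => h2 v (Finset.mem_erase.2 ⟨by omega, hv⟩) (by omega)⟩,
          h1.2⟩
  · refine congrArg Finset.card (Finset.filter_congr fun X hX => and_congr_right fun hXS => ?_)
    constructor
    · intro h2 v hv hiv
      rcases hiv.eq_or_lt with rfl | hlt
      · refine absurd ⟨mem_dominators_of_kernel hX hXS fun w hw => ?_, hv⟩ h
        by_contra hwn
        rw [Finset.mem_range] at hwn
        exact hwn (Finset.mem_range.1 ((mem_kernels.1 hX).1 (h2 w hw (by omega))))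
      · exact h2 v hv hlt
    · exact fun h2 v hv hiv => h2 v hv (by omega)

/-- With nothing to cover below 0, the entries of a tuple are chosen independently. For `k = 0` the
empty tuple would be counted even on vertex sets that are not dominating, where the table holds 0.
-/
theorem covers_zero {k : ℕ} (hk : 0 < k) :
    covers n A k 0 = powerTable k (dominators n A n) (zeta n A n) := by
  funext S
  unfold powerTable
  split_ifs with h
  · have hS : ∀ v ∈ S, v < n := fun v hv =>
      Finset.mem_range.1 (((mem_dominators le_rfl).1 h).1 hv)
    have h1 : ((Fintype.piFinset fun _ : Fin k => kernels n A).filter fun t =>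
        (∀ j, t j ⊆ S) ∧ ∀ v ∈ S, v < 0 ∨ n ≤ v → ∃ j, v ∈ t j) =
        Fintype.piFinset fun _ : Fin k => (kernels n A).filter fun X =>
          X ⊆ S ∧ ∀ v ∈ S, n ≤ v → v ∈ X := by
      ext t
      simp only [Finset.mem_filter, Fintype.mem_piFinset]
      constructor
      · exact fun h j => ⟨h.1 j, h.2.1 j, fun v hv hv' => absurd (hS v hv) hv'.not_gt⟩
      · refine fun h => ⟨fun j => (h j).1, fun j => (h j).2.1, fun v hv hv' => ?_⟩
        have := hS v hv
        omega
    rw [covers, h1, Fintype.card_piFinset_const, zeta]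
  · have h1 : zeta n A n S = 0 := by
      rw [zeta, Finset.card_eq_zero, Finset.filter_eq_empty_iff]
      rintro X hX ⟨hXS, hSX⟩
      refine h (mem_dominators_of_kernel hX hXS fun v hv => ?_)
      by_contra hvn
      exact hvn ((mem_kernels.1 hX).1 (hSX v hv (by simpa using hvn)))
    rw [h1, covers, Finset.card_eq_zero, Finset.filter_eq_empty_iff]
    rintro t ht ⟨htS, hSt⟩
    rw [Fintype.mem_piFinset] at ht
    refine h (mem_dominators_of_kernel (ht ⟨0, hk⟩) (htS _) fun v hv => ?_)
    by_contra hvn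
    obtain ⟨j, hj⟩ := hSt v hv (.inr (by simpa using hvn))
    exact hvn ((mem_kernels.1 (ht j)).1 hj)

/-- Among the tuples counted for `S` at stage `i`, those that miss `i` are exactly the tuples
counted for `S.erase i`. Hence the subtrahend never exceeds the minuend. -/
theorem covers_succ {k i : ℕ} (hk : 0 < k) (hi : i < n) :
    covers n A k (i + 1) = sweepTable (· - ·) i (dominators n A n) (covers n A k i) := by
  funext S
  unfold sweepTable
  split_ifs with h
  · refine (Nat.sub_eq_of_eq_add ?_).symm
    unfold covers
    rw [← Finset.card_filter_add_card_filter_not (fun t : Fin k → Finset ℕ => ∃ j, i ∈ t j),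
      Finset.filter_filter, Finset.filter_filter]
    congr 2 <;> refine Finset.filter_congr fun t _ => ?_
    · constructor
      · rintro ⟨⟨h1, h2⟩, h3⟩
        refine ⟨h1, fun v hv hiv => ?_⟩
        rcases eq_or_ne v i with rfl | hne
        exacts [h3, h2 v hv (by omega)]
      · rintro ⟨h1, h2⟩
        exact ⟨⟨h1, fun v hv hiv => h2 v hv (by omega)⟩, h2 i h.2 (by omega)⟩
    · constructor
      · rintro ⟨⟨h1, h2⟩, h3⟩
        refine ⟨fun j => Finset.subset_erase.2 ⟨h1 j, fun h => h3 ⟨j, h⟩⟩, fun v hv hiv => ?_⟩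
        exact h2 v (Finset.mem_of_mem_erase hv) hiv
      · rintro ⟨h1, h2⟩
        simp only [Finset.subset_erase] at h1
        refine ⟨⟨fun j => (h1 j).1, fun v hv hiv => h2 v (Finset.mem_erase.2 ⟨by omega, hv⟩) hiv⟩,
          fun ⟨j, hj⟩ => (h1 j).2 hj⟩
  · refine congrArg Finset.card (Finset.filter_congr fun t ht => and_congr_right fun htS => ?_)
    rw [Fintype.mem_piFinset] at ht
    constructor
    · exact fun h2 v hv hiv => h2 v hv (by omega)
    · intro h2 v hv hiv
      rcases eq_or_ne v i with rfl | hne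
      · refine absurd ⟨mem_dominators_of_kernel (ht ⟨0, hk⟩) (htS _) fun w hw => ?_, hv⟩ h
        by_contra hwn
        obtain ⟨j, hj⟩ := h2 w hw (.inr (by simpa using hwn))
        exact hwn ((mem_kernels.1 (ht j)).1 hj)
      · exact h2 v hv (by omega)

theorem card_kernels_le : (kernels n A).card ≤ 2 ^ n := by
  refine (Finset.card_filter_le _ _).trans ?_
  rw [List.toFinset_card_of_nodup (nodup_dominators le_rfl)]
  exact length_dominators_le n A

theorem zeta_le (i : ℕ) (S : Finset ℕ) : zeta n A i S ≤ 2 ^ n :=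
  (Finset.card_filter_le _ _).trans card_kernels_le

theorem covers_le (k i : ℕ) (S : Finset ℕ) : covers n A k i S ≤ (2 ^ n) ^ k := by
  refine (Finset.card_filter_le _ _).trans ?_
  rw [Fintype.card_piFinset_const]
  exact Nat.pow_le_pow_left card_kernels_le _

theorem covers_range_ne_zero {k : ℕ} : covers n A k n (Finset.range n) ≠ 0 ↔
    ∃ t : Fin k → Finset ℕ, (∀ j, t j ∈ kernels n A) ∧ ∀ v < n, ∃ j, v ∈ t j := by
  rw [covers, Finset.card_ne_zero]
  simp only [Finset.Nonempty, Finset.mem_filter, Fintype.mem_piFinset, Finset.mem_range]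
  refine exists_congr fun t => and_congr_right fun ht => ?_
  constructor
  · exact fun h v hv => h.2 v hv (.inl hv)
  · exact fun h => ⟨fun j => (mem_kernels.1 (ht j)).1, fun v hv _ => h v hv⟩

end Ram

/-! ### Shearer's inequality and the number of dominating sets. -/

section Shearer

/-- Superadditivity of the geometric mean, for two summands. -/
theorem add_pow_card_le_prod_add {ι : Type*} {J : Finset ι} {k x y P : ℕ} {a b : ι → ℕ}
    (hk : 0 < k) (hJ : J.card = k) (hx : x ^ k ≤ P * ∏ i ∈ J, a i)
    (hy : y ^ k ≤ P * ∏ i ∈ J, b i) : (x + y) ^ k ≤ P * ∏ i ∈ J, (a i + b i) := by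
  -- The main argument divides by each `a i + b i`; if one of them is 0, then `x = y = 0`.
  by_cases h0 : ∃ i ∈ J, a i + b i = 0
  · obtain ⟨i, hi, h⟩ := h0
    rw [Finset.prod_eq_zero hi (by omega), mul_zero, Nat.le_zero, pow_eq_zero_iff hk.ne'] at hx hy
    simp [hx, hy, hk.ne']
  push Not at h0
  have hkR : (0 : ℝ) < k := by exact_mod_cast hk
  have hc : ∀ i ∈ J, (0 : ℝ) < a i + b i := fun i hi => by
    exact_mod_cast Nat.pos_of_ne_zero (h0 i hi)
  set Q : ℝ := (P * ∏ i ∈ J, ((a i : ℝ) + b i)) with hQ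
  have hQ0 : 0 ≤ Q := mul_nonneg (Nat.cast_nonneg _) (Finset.prod_nonneg fun i hi => (hc i hi).le)
  -- Take `k`-th roots and apply the inequality of the means to the ratios `e i / (a i + b i)`. For
  -- `e = a` and `e = b` the two arithmetic means add up to 1.
  have key : ∀ (z : ℕ) (e : ι → ℕ), z ^ k ≤ P * ∏ i ∈ J, e i →
      (z : ℝ) ≤ Q ^ (1 / k : ℝ) * ∑ i ∈ J, (1 / k : ℝ) * (e i / (a i + b i)) := by
    intro z e hz
    have h1 : (z : ℝ) = ((z : ℝ) ^ k) ^ (1 / k : ℝ) := by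
      rw [one_div, Real.pow_rpow_inv_natCast (Nat.cast_nonneg _) hk.ne']
    have h2 : (z : ℝ) ^ k ≤ Q * ∏ i ∈ J, ((e i : ℝ) / (a i + b i)) := by
      rw [hQ, mul_assoc, ← Finset.prod_mul_distrib,
        Finset.prod_congr rfl fun i hi => mul_div_cancel₀ (e i : ℝ) (hc i hi).ne']
      exact_mod_cast hz
    have h3 : ∀ i ∈ J, 0 ≤ (e i : ℝ) / (a i + b i) := fun i hi =>
      div_nonneg (Nat.cast_nonneg _) (hc i hi).le
    rw [h1]
    refine (Real.rpow_le_rpow (by positivity) h2 (by positivity)).trans ?_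
    rw [Real.mul_rpow hQ0 (Finset.prod_nonneg h3), ← Real.finsetProd_rpow _ _ h3]
    refine mul_le_mul_of_nonneg_left ?_ (Real.rpow_nonneg hQ0 _)
    refine Real.geom_mean_le_arith_mean_weighted _ _ _ (fun _ _ => by positivity) ?_ h3
    rw [Finset.sum_const, hJ, nsmul_eq_mul, mul_one_div_cancel hkR.ne']
  have h4 : ∑ i ∈ J, (1 / k : ℝ) * (a i / (a i + b i)) +
      ∑ i ∈ J, (1 / k : ℝ) * (b i / (a i + b i)) = 1 := by
    rw [← Finset.sum_add_distrib, Finset.sum_congr rfl (g := fun _ => (1 / k : ℝ)), Finset.sum_const,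
      hJ, nsmul_eq_mul, mul_one_div_cancel hkR.ne']
    intro i hi
    rw [← mul_add, ← add_div, div_self (hc i hi).ne', mul_one]
  have h5 : (x + y : ℝ) ≤ Q ^ (1 / k : ℝ) := by
    have := add_le_add (key x a hx) (key y b hy)
    rwa [← mul_add, h4, mul_one] at this
  have h6 : (x + y : ℝ) ^ k ≤ Q := by
    refine (pow_le_pow_left₀ (by positivity) h5 k).trans (le_of_eq ?_)
    rw [one_div, Real.rpow_inv_natCast_pow hQ0 hk.ne']
  rw [hQ] at h6
  exact_mod_cast h6

/-- Shearer's inequality for the traces of a set family. -/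
theorem card_pow_le_prod_card_trace {α ι : Type*} [DecidableEq α] {k : ℕ} (hk : 0 < k)
    (I : Finset ι) (B : ι → Finset α) (U : Finset α)
    (hU : ∀ x ∈ U, k ≤ (I.filter fun i => x ∈ B i).card) (F : Finset (Finset α))
    (hF : ∀ S ∈ F, S ⊆ U) : F.card ^ k ≤ ∏ i ∈ I, (F.image (· ∩ B i)).card := by
  classical
  induction U using Finset.induction_on generalizing F with
  | empty =>
    have hF' : F ⊆ {∅} := fun S hS => by
      rw [Finset.mem_singleton, ← Finset.subset_empty]
      exact hF S hS
    rcases Finset.subset_singleton_iff.1 hF' with rfl | rfl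
    · simp [hk.ne']
    · simp
  | insert x U hx ih =>
    -- Split the family by membership of `x`. On exactly `k` of the sets `B i` that contain `x` the
    -- trace counts of the two halves add up; for the other indices monotonicity is enough.
    obtain ⟨J, hJI, hJ⟩ := Finset.exists_subset_card_eq (hU x (Finset.mem_insert_self _ _))
    set F₀ := F.filter fun S => x ∉ S with hF₀
    set F₁ := (F.filter fun S => x ∈ S).image (·.erase x) with hF₁
    have hU' : ∀ y ∈ U, k ≤ (I.filter fun i => y ∈ B i).card := fun y hy =>
      hU y (Finset.mem_insert_of_mem hy)
    have h₀ := ih hU' F₀ fun S hS => by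
      rw [hF₀, Finset.mem_filter] at hS
      exact (Finset.subset_insert_iff_of_notMem hS.2).1 (hF S hS.1)
    have h₁ := ih hU' F₁ fun S hS => by
      rw [hF₁, Finset.mem_image] at hS
      obtain ⟨T, hT, rfl⟩ := hS
      exact Finset.subset_insert_iff.1 (hF T (Finset.mem_filter.1 hT).1)
    have hcard : F.card = F₀.card + F₁.card := by
      rw [hF₁, Finset.card_image_of_injOn, add_comm, Finset.card_filter_add_card_filter_not]
      intro S hS T hT h
      rw [Finset.mem_coe, Finset.mem_filter] at hS hT
      rw [← Finset.insert_erase hS.2, ← Finset.insert_erase hT.2]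
      exact congrArg _ h
    have hJ' : I.filter (· ∈ J) = J := by
      rw [Finset.filter_mem_eq_inter, Finset.inter_eq_right]
      exact hJI.trans (Finset.filter_subset _ _)
    have hmono₀ : ∀ i, (F₀.image (· ∩ B i)).card ≤ (F.image (· ∩ B i)).card := fun i =>
      Finset.card_le_card (Finset.image_subset_image (Finset.filter_subset _ _))
    have hmono₁ : ∀ i, (F₁.image (· ∩ B i)).card ≤ (F.image (· ∩ B i)).card := fun i => by
      refine le_trans (Finset.card_le_card ?_)
        (Finset.card_image_le (s := F.image (· ∩ B i)) (f := (·.erase x)))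
      intro T hT
      simp only [hF₁, Finset.mem_image, Finset.mem_filter] at hT ⊢
      obtain ⟨_, ⟨S, hS, rfl⟩, rfl⟩ := hT
      exact ⟨_, ⟨S, hS.1, rfl⟩, (Finset.erase_inter _ _ _).symm⟩
    -- As `x ∈ B i`, traces of `F₁` become traces of `F` when `x` is put back, and they differ from
    -- those of `F₀`, which lack `x`.
    have hsum : ∀ i ∈ J, (F₀.image (· ∩ B i)).card + (F₁.image (· ∩ B i)).card ≤
        (F.image (· ∩ B i)).card := fun i hi => by
      have hxi : x ∈ B i := (Finset.mem_filter.1 (hJI hi)).2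
      have hinj : Set.InjOn (insert x) (F₁.image (· ∩ B i) : Set (Finset α)) := by
        intro S hS T hT h
        simp only [hF₁, Finset.coe_image, Set.mem_image, Finset.mem_coe,
          Finset.mem_filter] at hS hT
        obtain ⟨_, ⟨S, -, rfl⟩, rfl⟩ := hS
        obtain ⟨_, ⟨T, -, rfl⟩, rfl⟩ := hT
        have := congrArg (·.erase x) h
        simpa using this
      rw [← Finset.card_image_of_injOn hinj, ← Finset.card_union_of_disjoint]
      · refine Finset.card_le_card (Finset.union_subset ?_ ?_)
        · exact Finset.image_subset_image (Finset.filter_subset _ _)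
        · intro T hT
          simp only [hF₁, Finset.mem_image, Finset.mem_filter] at hT ⊢
          obtain ⟨_, ⟨_, ⟨S, hS, rfl⟩, rfl⟩, rfl⟩ := hT
          refine ⟨S, hS.1, ?_⟩
          rw [Finset.erase_inter, Finset.insert_erase (Finset.mem_inter.2 ⟨hS.2, hxi⟩)]
      · rw [Finset.disjoint_left]
        intro T hT hT'
        simp only [hF₀, Finset.mem_image, Finset.mem_filter] at hT hT'
        obtain ⟨S, hS, rfl⟩ := hT
        obtain ⟨T', -, hT'⟩ := hT'
        have : x ∈ S ∩ B i := hT' ▸ Finset.mem_insert_self _ _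
        exact hS.2 (Finset.mem_inter.1 this).1
    have split : ∀ f : ι → ℕ, ∏ i ∈ I, f i = (∏ i ∈ I.filter (· ∉ J), f i) * ∏ i ∈ J, f i :=
      fun f => by
        rw [← Finset.prod_filter_mul_prod_filter_not I (· ∈ J), hJ', mul_comm]
    rw [split] at h₀ h₁ ⊢
    rw [hcard]
    refine (add_pow_card_le_prod_add hk hJ
      (h₀.trans (Nat.mul_le_mul_right _ (Finset.prod_le_prod' fun i _ => hmono₀ i)))
      (h₁.trans (Nat.mul_le_mul_right _ (Finset.prod_le_prod' fun i _ => hmono₁ i)))).trans ?_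
    exact Nat.mul_le_mul_left _ (Finset.prod_le_prod' hsum)

/-- A family of sets that meet all closed neighbourhoods of a graph is small if the graph has
small degrees. -/
theorem card_pow_le_of_forall_inter_nonempty {n d : ℕ} {N : ℕ → Finset ℕ}
    (hN : ∀ v < n, N v ⊆ Finset.range n ∧ v ∈ N v ∧ (N v).card ≤ d + 1)
    (hsymm : ∀ u < n, ∀ v < n, v ∈ N u → u ∈ N v) {F : Finset (Finset ℕ)}
    (hF : ∀ S ∈ F, S ⊆ Finset.range n ∧ ∀ v < n, (S ∩ N v).Nonempty) :
    F.card ^ (d + 1) ≤ (2 ^ (d + 1) - 1) ^ n := by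
  -- Each vertex `v` gets `d + 1` slots: first `N v`, then `d + 1 - |N v|` copies of `{v}`, then
  -- empty sets. By symmetry `u` lies in `|N u|` neighbourhoods, so the copies raise its
  -- multiplicity to `d + 1`.
  let B : ℕ × ℕ → Finset ℕ := fun q =>
    if q.2 = 0 then N q.1 else if q.2 ≤ d + 1 - (N q.1).card then {q.1} else ∅
  have h := card_pow_le_prod_card_trace (Nat.succ_pos d) (Finset.range n ×ˢ Finset.range (d + 1))
    B (Finset.range n) ?_ F fun S hS => (hF S hS).1
  · refine h.trans ?_
    rw [Finset.prod_product]
    refine (Finset.prod_le_pow_card _ _ (2 ^ (d + 1) - 1) fun v hv => ?_).trans (by simp)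
    rw [Finset.mem_range] at hv
    obtain ⟨h1, h2, h3⟩ := hN v hv
    have h4 : 0 < (N v).card := Finset.card_pos.2 ⟨v, h2⟩
    rw [Finset.prod_range_succ']
    have h5 : (F.image (· ∩ B (v, 0))).card ≤ 2 ^ (N v).card - 1 := by
      rw [← Finset.card_powerset, ← Finset.card_erase_of_mem (Finset.empty_mem_powerset _)]
      refine Finset.card_le_card fun T hT => ?_
      obtain ⟨S, hS, rfl⟩ := Finset.mem_image.1 hT
      rw [Finset.mem_erase, Finset.mem_powerset]
      exact ⟨((hF S hS).2 v hv).ne_empty, Finset.inter_subset_right⟩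
    have h6 : ∏ t ∈ Finset.range d, (F.image (· ∩ B (v, t + 1))).card ≤
        2 ^ (d + 1 - (N v).card) := by
      have h7 : ∀ t ∈ Finset.range d, (F.image (· ∩ B (v, t + 1))).card ≤
          if t < d + 1 - (N v).card then 2 else 1 := by
        intro t _
        have h8 : (F.image (· ∩ B (v, t + 1))).card ≤ 2 ^ (B (v, t + 1)).card := by
          rw [← Finset.card_powerset]
          refine Finset.card_le_card fun T hT => ?_
          obtain ⟨S, -, rfl⟩ := Finset.mem_image.1 hT
          exact Finset.mem_powerset.2 Finset.inter_subset_right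
        refine h8.trans ?_
        simp only [B, Nat.succ_ne_zero, if_false, Nat.succ_le_iff]
        split_ifs <;> simp
      refine (Finset.prod_le_prod' h7).trans ?_
      rw [Finset.prod_ite, Finset.prod_const, Finset.prod_const_one, mul_one]
      refine Nat.pow_le_pow_right (by norm_num) ?_
      refine (Finset.card_le_card (t := Finset.range (d + 1 - (N v).card)) ?_).trans (by simp)
      intro t ht
      exact Finset.mem_range.2 (Finset.mem_filter.1 ht).2
    -- With `m = |N v|`, this is `2 ^ (d + 1 - m) * (2 ^ m - 1) ≤ 2 ^ (d + 1) - 1`.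
    refine (Nat.mul_le_mul h6 h5).trans ?_
    have h7 : 2 ^ (d + 1) = 2 ^ (d + 1 - (N v).card) * 2 ^ (N v).card := by
      rw [← pow_add]
      congr 1
      omega
    have h8 := Nat.two_pow_pos (d + 1 - (N v).card)
    rw [Nat.mul_sub_one, h7]
    omega
  · intro u hu
    rw [Finset.mem_range] at hu
    obtain ⟨h1, h2, h3⟩ := hN u hu
    have h4 : d + 1 = (N u ×ˢ {0} ∪ {u} ×ˢ Finset.Icc 1 (d + 1 - (N u).card)).card := by
      rw [Finset.card_union_of_disjoint]
      · simp
        omega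
      · rw [Finset.disjoint_left]
        rintro ⟨v, t⟩ h h'
        simp only [Finset.mem_product, Finset.mem_singleton, Finset.mem_Icc] at h h'
        omega
    refine h4.le.trans (Finset.card_le_card ?_)
    rintro ⟨v, t⟩ h
    have h5 : 0 < (N u).card := Finset.card_pos.2 ⟨u, h2⟩
    simp only [Finset.mem_union, Finset.mem_product, Finset.mem_singleton, Finset.mem_Icc] at h
    simp only [Finset.mem_filter, Finset.mem_product, Finset.mem_range, B]
    rcases h with ⟨hv, rfl⟩ | ⟨rfl, ht⟩
    · have hvn := Finset.mem_range.1 (h1 hv)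
      exact ⟨⟨hvn, by omega⟩, by simpa using hsymm u hu v hvn hv⟩
    · refine ⟨⟨hu, by omega⟩, ?_⟩
      rw [if_neg (by omega), if_pos ht.2]
      simp

end Shearer

/-! ### The main program. -/

namespace Ram

def doubling : Prog := block [
  .set 14 (.mul (.const 2) (.reg 14)),
  .set 10 (.add (.reg 10) (.const 1))]

/-- Lists the dominating sets, counts for each of them its maximal independent subsets, and
deduces the number of coverings by as many maximal independent sets as register 1 says. -/
def core : Prog := block [
  .set 14 (.const 1),
  .loop (.sub (.reg 0) (.reg 10)) doubling,
  .set 9 (.sub (.reg 14) (.const 1)),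
  scan,
  .store (.add (.mul (.reg 0) (.reg 0)) (.const 1)) (.reg 9),
  .store (.slot (.reg 9)) (.sub (.const 1) (.reg 8)),
  .set 7 (.const 0),
  .set 8 (.const 0),
  .set 9 (.const 0),
  .set 10 (.const 0),
  .set 13 (.const 1),
  .set 14 (.const 1),
  .loop (.sub (.reg 0) (.reg 10)) growRound,
  .set 10 (.const 0),
  .set 14 (.const 1),
  sweeps .add,
  powers,
  sweeps .sub,
  -- List entry 0 is the full vertex set, and `1 - (1 - x)` turns its count into the answer 0 or 1.
  .set 0 (.sub (.const 1) (.sub (.const 1) (.load (.slot (.item (.const 0))))))]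

/-- The number of instructions that `core` executes on a graph with `n` vertices and `D`
dominating sets. -/
def coreTime (n k D : ℕ) : ℕ :=
  n * 4 + scanTime n + n * (D * (scanTime n + 12) + 8) + 2 * (n * (D * 8 + 6)) +
    D * (k * 4 + 10) + 30

theorem getElem?_zero_dominators (n : ℕ) (A : ℕ → ℕ) (i : ℕ) :
    (dominators n A i)[0]? = some (Finset.range n) := by
  induction i with
  | zero => rfl
  | succ i ih =>
    have := (List.getElem?_eq_some_iff.1 ih).1
    rw [dominators, List.getElem?_append_left this, ih]

theorem ex_doubling_loop {n k b : ℕ} (hb : 2 * n + n * n + 5 ≤ b) (hb' : 2 ^ n < b)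
    {m : ℕ → ℕ} :
    Ex b (.loop (.sub (.reg 0) (.reg 10)) doubling) (n * 4 + 1)
      (St [n, k, 0, 0, 0, 0, 0, 0, 0, 0, 0, 0, 0, 0, 1] m)
      (St [n, k, 0, 0, 0, 0, 0, 0, 0, 0, n, 0, 0, 0, 2 ^ n] m) := by
  have h := Ex.loop (b := b) (N := 3) (m := n) (P := doubling)
    (e := .sub (.reg 0) (.reg 10))
    (fun i => St [n, k, 0, 0, 0, 0, 0, 0, 0, 0, i, 0, 0, 0, 2 ^ i] m)
    (by decide) ?_ ?_ ?_ ?_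
  · simpa using h
  · intro i hi
    simp
    omega
  · intro i hi
    simp
    omega
  · simp
  · intro i hi
    have h3 : 2 ^ i < 2 ^ n := Nat.pow_lt_pow_right (by norm_num) hi
    refine Ex.cons_set ?_ (by decide) (by simp) ?_
    · simp
      omega
    refine Ex.cons_set ?_ (by decide) (by simp) (Ex.nil ?_)
    · simp
      omega
    simp [pow_succ, mul_comm]

/-- There are at most `2 ^ n` kernels and `k < n`, so `(2 ^ n) ^ n` bounds all powers and counts
that occur. -/
theorem ex_core {n k b : ℕ} {A : ℕ → ℕ} (hA : ∀ a, A a ≤ 1) (hk : 0 < k) (hkn : k < n)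
    (hb : 2 * n + n * n + 5 ≤ b) (hb' : (2 ^ n) ^ n < b) :
    ∃ s, Ex b core (coreTime n k (dominators n A n).length)
      (St [n, k, 0, 0, 0, 0, 0, 0, 0, 0, 0, 0, 0, 0, 0] (memo n A [] 0)) s ∧
      s.reg 0 = 1 - (1 - covers n A k n (Finset.range n)) := by
  have hn : 2 ^ n ≤ (2 ^ n) ^ n := Nat.le_self_pow (by omega) _
  have hpow : ∀ t ≤ k, (2 ^ n) ^ t < b := fun t ht =>
    (Nat.pow_le_pow_right (Nat.two_pow_pos n) (by omega)).trans_lt hb'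
  have hbn : 2 ^ n < b := by omega
  have hD := length_dominators_le n A
  have hnodup : (dominators n A n).Nodup := nodup_dominators le_rfl
  have hsub : ∀ S ∈ dominators n A n, S ⊆ Finset.range n := fun S hS =>
    ((mem_dominators le_rfl).1 hS).1
  have hzeta : ∀ i S, zeta n A i S < b := fun i S => (zeta_le i S).trans_lt hbn
  have hcov : ∀ i S, covers n A k i S < b := fun i S => (covers_le k i S).trans_lt (hpow k le_rfl)
  have hcode := code_range n
  have hclash := clashes_le (n := n) hA (Finset.range n) n
  have hget := getElem?_zero_dominators n A n
  have hstore : Function.update (memo n A [] 0) (n * n + 1) (code (Finset.range n)) =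
      memo n A [Finset.range n] 0 := by
    simpa using update_memo_list n A [] 0 (Finset.range n)
  have htable : Function.update (0 : Finset ℕ → ℕ) (Finset.range n) (1 - clashes n A (Finset.range n) n) =
      indepTable n A [Finset.range n] := by
    rw [show (0 : Finset ℕ → ℕ) = indepTable n A [] by funext S; simp [indepTable],
      update_indepTable, List.nil_append]
  refine ⟨St [1 - (1 - covers n A k n (Finset.range n)), k, 0, 0, 0, 0, 0, 0, 0, 0, 0, 0, 0,
    (dominators n A n).length, 1] (memo n A (dominators n A n) (covers n A k n)),
    Ex.mono (N := 2 + (n * ((dominators n A n).length * 8 + 6) + 4) +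
    ((dominators n A n).length * (k * 4 + 10) + 3) +
    (n * ((dominators n A n).length * 8 + 6) + 4) + 2 +
    (n * ((dominators n A n).length * (scanTime n + 12) + 8) + 1) +
    8 + scanTime n + 1 + (n * 4 + 1) + 1) ?_ (by unfold coreTime; omega), rfl⟩
  refine Ex.cons_set ?_ (by decide) (by simp) ?_
  · simp
    omega
  refine Ex.cons (ex_doubling_loop hb hbn) ?_
  refine Ex.cons_set ?_ (by decide) (by simp) ?_
  · simp
    omega
  simp only [Expr.val, St_reg, List.getD_cons_succ, List.getD_cons_zero, List.set_cons_succ,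
    List.set_cons_zero, ← hcode]
  refine Ex.cons (ex_scan hA hb (by omega)) ?_
  refine Ex.cons_store ?_ ?_ (by decide) (by decide) ?_
  · simp
    omega
  · simp
    omega
  simp only [Expr.val, St_reg, List.getD_cons_succ, List.getD_cons_zero, hstore]
  refine Ex.cons_store ?_ ?_ (by decide) (by decide) ?_
  · simp [Expr.slot]
    omega
  · simp
    omega
  simp only [Expr.val, Expr.slot, St_reg, List.getD_cons_succ, List.getD_cons_zero,
    update_memo_table, htable]
  refine Ex.cons_set ?_ (by decide) (by simp) ?_
  · simp
    omega
  refine Ex.cons_set ?_ (by decide) (by simp) ?_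
  · simp
    omega
  refine Ex.cons_set ?_ (by decide) (by simp) ?_
  · simp
    omega
  refine Ex.cons_set ?_ (by decide) (by simp) ?_
  · simp
    omega
  refine Ex.cons_set ?_ (by decide) (by simp) ?_
  · simp
    omega
  refine Ex.cons_set ?_ (by decide) (by simp) ?_
  · simp
    omega
  refine Ex.cons (ex_growRound_loop hA hb hbn) ?_
  refine Ex.cons_set ?_ (by decide) (by simp) ?_
  · simp
    omega
  refine Ex.cons_set ?_ (by decide) (by simp) ?_
  · simp
    omega
  rw [← zeta_zero]
  refine Ex.cons (ex_sweeps computes_add hb hbn hnodup (by omega) hsub (fun i _ => hzeta i)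
    fun i => zeta_succ) ?_
  refine Ex.cons (ex_powers hb hbn (by omega) hnodup (by omega) hsub (hzeta n)
    fun S t ht => (Nat.pow_le_pow_left (zeta_le n S) t).trans_lt (hpow t ht)) ?_
  rw [← covers_zero hk]
  refine Ex.cons (ex_sweeps computes_sub hb hbn hnodup (by omega) hsub (fun i _ => hcov i)
    fun i => covers_succ hk) ?_
  have hitem : memo n A (dominators n A n) (covers n A k n) (n * n + 1) =
      code (Finset.range n) := by
    simpa [hget] using memo_list n A (dominators n A n) (covers n A k n) 0
  refine Ex.cons_set ?_ (by decide) (by simp) (Ex.nil ?_)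
  · simp [Expr.item, hitem, hcov]
    omega
  · simp [Expr.item, hitem]

/-! ### From adjacency matrices to graphs. -/

variable {n : ℕ} {G : SimpleGraph (Fin n)} {k : ℕ}

theorem graphInput_mem_le (G : SimpleGraph (Fin n)) (k a : ℕ) : (graphInput G k).mem a ≤ 1 := by
  simp only [graphInput]
  split_ifs <;> simp

theorem graphInput_mem_ne_zero {v u : ℕ} (hv : v < n) (hu : u < n) :
    (graphInput G k).mem (v * n + u) ≠ 0 ↔ G.Adj ⟨v, hv⟩ ⟨u, hu⟩ := by
  simp only [graphInput, ne_eq, ite_eq_right_iff, one_ne_zero, imp_false, not_not]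
  constructor
  · rintro ⟨v', u', h, hadj⟩
    have hn : 0 < n := by omega
    have h1 : v = v' := by
      have := congrArg (· / n) h
      simpa [Nat.add_div_of_dvd_right, hn, Nat.div_eq_of_lt hu, Nat.div_eq_of_lt u'.2] using this
    have h2 : u = u' := by
      rw [h1] at h
      omega
    convert hadj
  · exact fun h => ⟨⟨v, hv⟩, ⟨u, hu⟩, rfl, h⟩

theorem graphInput_eq_St (G : SimpleGraph (Fin n)) (k : ℕ) :
    graphInput G k = St [n, k, 0, 0, 0, 0, 0, 0, 0, 0, 0, 0, 0, 0, 0]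
      (memo n (graphInput G k).mem [] 0) := by
  have hreg : (graphInput G k).reg =
      fun i => [n, k, 0, 0, 0, 0, 0, 0, 0, 0, 0, 0, 0, 0, 0].getD i 0 := by
    funext i
    rcases i with _ | _ | i
    · rfl
    · rfl
    · simp only [graphInput]
      by_cases hi : i < 13
      · interval_cases i <;> rfl
      · rw [List.getD_eq_default _ _ (by simp; omega)]
        simp
  have hmem : (graphInput G k).mem = memo n (graphInput G k).mem [] 0 := by
    funext a
    unfold memo
    split_ifs with h1 h2
    · rfl
    all_goals
      simp only [graphInput]
      rw [if_neg]
      · simp [code]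
      · rintro ⟨v, u, rfl, -⟩
        have := v.2
        have := u.2
        nlinarith
  rw [St, ← hreg, ← hmem]

/-- A maximal independent set is dominating, since a vertex that it does not dominate could be
added. -/
theorem exists_kernel_superset {T : Finset ℕ} (hT : T ⊆ Finset.range n)
    (hT' : clashes n (graphInput G k).mem T n = 0) :
    ∃ X ∈ kernels n (graphInput G k).mem, T ⊆ X := by
  obtain ⟨X, hTX, hX⟩ := ((Finset.range n).powerset.filter fun S =>
    clashes n (graphInput G k).mem S n = 0).exists_le_maximal (a := T) (by simp [hT, hT'])
  have hX' := Finset.mem_filter.1 hX.1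
  rw [Finset.mem_powerset] at hX'
  refine ⟨X, mem_kernels.2 ⟨hX'.1, missed_eq_zero.2 fun v hv => ?_, hX'.2⟩, hTX⟩
  by_contra! hcon
  have hvX : v ∉ X := fun h => (hcon v hv h).1 rfl
  refine hvX (hX.2 (y := insert v X) ?_ (Finset.subset_insert _ _) (Finset.mem_insert_self _ _))
  refine Finset.mem_filter.2 ⟨Finset.mem_powerset.2 ?_, ?_⟩
  · exact Finset.insert_subset (Finset.mem_range.2 hv) hX'.1
  refine clashes_eq_zero.2 ?_
  intro w hw u hu huX hwX
  rw [Finset.mem_insert] at huX hwX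
  by_contra hne
  have hadj := (graphInput_mem_ne_zero hw hu).1 hne
  rcases huX with rfl | huX <;> rcases hwX with rfl | hwX
  · exact G.loopless.irrefl _ hadj
  · exact (graphInput_mem_ne_zero (k := k) hv hw).2 hadj.symm (hcon w hw hwX).2
  · exact hne (hcon u hu huX).2
  · exact hne (clashes_eq_zero.1 hX'.2 w hw u hu huX hwX)

theorem covers_ne_zero_iff : covers n (graphInput G k).mem k n (Finset.range n) ≠ 0 ↔
    CoveredByIndepSets G k := by
  classical
  rw [covers_range_ne_zero]
  constructor
  · rintro ⟨t, ht, hcov⟩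
    refine ⟨fun j => {v | v.1 ∈ t j}, fun j u hu v hv _ hadj => ?_, ?_⟩
    · exact (graphInput_mem_ne_zero (k := k) u.2 v.2).2 hadj
        (clashes_eq_zero.1 (mem_kernels.1 (ht j)).2.2 u u.2 v v.2 hv hu)
    · rw [Set.eq_univ_iff_forall]
      intro v
      obtain ⟨j, hj⟩ := hcov v v.2
      exact Set.mem_iUnion.2 ⟨j, hj⟩
  · rintro ⟨S, hS, hcov⟩
    have h : ∀ j, ∃ X ∈ kernels n (graphInput G k).mem,
        (S j).toFinset.image Fin.val ⊆ X := fun j => by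
      refine exists_kernel_superset (fun v hv => ?_) (clashes_eq_zero.2 ?_)
      · obtain ⟨v, -, rfl⟩ := Finset.mem_image.1 hv
        exact Finset.mem_range.2 v.2
      · intro v hv u hu huS hvS
        rw [Finset.mem_image] at huS hvS
        obtain ⟨u, huS, rfl⟩ := huS
        obtain ⟨v, hvS, rfl⟩ := hvS
        rw [Set.mem_toFinset] at huS hvS
        by_contra hne
        have hadj := (graphInput_mem_ne_zero hv hu).1 hne
        exact hS j hvS huS hadj.ne hadj
    choose t ht hSt using h
    refine ⟨t, ht, fun v hv => ?_⟩
    obtain ⟨j, hj⟩ := Set.mem_iUnion.1 (hcov.symm ▸ Set.mem_univ (⟨v, hv⟩ : Fin n))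
    exact ⟨j, hSt j (Finset.mem_image.2 ⟨_, Set.mem_toFinset.2 hj, rfl⟩)⟩

theorem coveredByIndepSets_of_le (h : n ≤ k) : CoveredByIndepSets G k := by
  refine ⟨fun i => {v | v.1 = i.1}, fun i u hu v hv hne => ?_, ?_⟩
  · exact absurd (Fin.ext (hu.trans hv.symm)) hne
  · rw [Set.eq_univ_iff_forall]
    exact fun v => Set.mem_iUnion.2 ⟨⟨v, v.2.trans_le h⟩, rfl⟩

theorem not_coveredByIndepSets_zero (h : 0 < n) : ¬ CoveredByIndepSets G 0 := by
  rintro ⟨S, -, hS⟩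
  obtain ⟨i, -⟩ := Set.mem_iUnion.1 (hS.symm ▸ Set.mem_univ (⟨0, h⟩ : Fin n))
  exact i.elim0

theorem length_dominators_pow_le [DecidableRel G.Adj] :
    (dominators n (graphInput G k).mem n).length ^ (G.maxDegree + 1) ≤
      (2 ^ (G.maxDegree + 1) - 1) ^ n := by
  rw [← List.toFinset_card_of_nodup (nodup_dominators le_rfl)]
  refine card_pow_le_of_forall_inter_nonempty
    (N := fun v => (Finset.range n).filter fun u =>
      u = v ∨ (graphInput G k).mem (v * n + u) ≠ 0) (fun v hv => ⟨?_, ?_, ?_⟩) ?_ ?_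
  · exact Finset.filter_subset _ _
  · simp [hv]
  · have hdeg := G.degree_le_maxDegree ⟨v, hv⟩
    refine le_trans (Finset.card_le_card
      (t := insert v ((G.neighborFinset ⟨v, hv⟩).image Fin.val)) fun u hu => ?_)
      ((Finset.card_insert_le _ _).trans (Nat.succ_le_succ (Finset.card_image_le.trans hdeg)))
    rw [Finset.mem_filter, Finset.mem_range] at hu
    rw [Finset.mem_insert]
    refine hu.2.imp_right fun h => Finset.mem_image.2 ⟨⟨u, hu.1⟩, ?_, rfl⟩
    rw [SimpleGraph.mem_neighborFinset]
    exact (graphInput_mem_ne_zero hv hu.1).1 h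
  · intro u hu v hv h
    rw [Finset.mem_filter, Finset.mem_range] at h ⊢
    refine ⟨hu, h.2.imp Eq.symm fun h => ?_⟩
    exact (graphInput_mem_ne_zero hv hu).2 ((graphInput_mem_ne_zero hu hv).1 h).symm
  · intro S hS
    rw [List.mem_toFinset, mem_dominators le_rfl] at hS
    refine ⟨hS.1, fun v hv => ?_⟩
    obtain ⟨u, hu, huS, h⟩ := missed_eq_zero.1 hS.2.1 v hv
    exact ⟨u, by simp [hu, huS, h]⟩

theorem length_dominators_le_rpow [DecidableRel G.Adj] :
    ((dominators n (graphInput G k).mem n).length : ℝ) ≤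
      ((2 : ℝ) ^ (G.maxDegree + 1) - 1) ^ ((n : ℝ) / ((G.maxDegree : ℝ) + 1)) := by
  have h := length_dominators_pow_le (G := G) (k := k)
  set D := (dominators n (graphInput G k).mem n).length
  have h1 : (1 : ℝ) ≤ 2 ^ (G.maxDegree + 1) := one_le_pow₀ (by norm_num)
  have h2 : ((D : ℝ)) ^ (G.maxDegree + 1) ≤ ((2 : ℝ) ^ (G.maxDegree + 1) - 1) ^ n := by
    have h3 : ((2 ^ (G.maxDegree + 1) - 1 : ℕ) : ℝ) = (2 : ℝ) ^ (G.maxDegree + 1) - 1 := by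
      rw [Nat.cast_sub Nat.one_le_two_pow]
      push_cast
      rfl
    rw [← h3]
    exact_mod_cast h
  have h4 : ((n : ℝ) / ((G.maxDegree : ℝ) + 1)) =
      (n : ℝ) * ((G.maxDegree + 1 : ℕ) : ℝ)⁻¹ := by
    push_cast
    rfl
  rw [h4, Real.rpow_mul (by linarith), Real.rpow_natCast,
    ← Real.pow_rpow_inv_natCast (Nat.cast_nonneg D) (Nat.succ_ne_zero G.maxDegree)]
  exact Real.rpow_le_rpow (by positivity) h2 (by positivity)

/-! ### The running time. -/

/-- Decides whether the input graph is covered by as many independent sets as register 1 says. -/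
def cover : Prog :=
  .cond (.sub (.reg 0) (.reg 1)) (.cond (.reg 1) core (.set 0 (.const 0))) (.set 0 (.const 1))

/-- A polynomial bound on the running time of `cover` per dominating set. -/
noncomputable def coverPoly : Polynomial ℕ :=
  (.X * 4 + .X * (.X * 6 + 10) + 7 + .X * (.X * (.X * 6 + 10) + 27) + 2 * (.X * 14) +
    (.X * 4 + 10) + 30) * (4000 * (.X * .X + .X + 8)) + (3 * .X + 10)

theorem eval_coverPoly (n : ℕ) : coverPoly.eval n =
    (n * 4 + scanTime n + n * (scanTime n + 20) + 2 * (n * 14) + (n * 4 + 10) + 30) *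
      (4000 * (n * n + n + 8)) + (3 * n + 10) := by
  simp only [coverPoly, Polynomial.eval_add, Polynomial.eval_mul, Polynomial.eval_X,
    Polynomial.eval_ofNat, scanTime]
  ring

theorem coreTime_le {k D : ℕ} (hk : k ≤ n) (hD : 0 < D) : coreTime n k D ≤
    (n * 4 + scanTime n + n * (scanTime n + 20) + 2 * (n * 14) + (n * 4 + 10) + 30) * D := by
  have h1 : D * (scanTime n + 12) + 8 ≤ (scanTime n + 20) * D := by nlinarith
  have h2 : D * 8 + 6 ≤ 14 * D := by omega
  have h3 : D * (k * 4 + 10) ≤ (n * 4 + 10) * D := by nlinarith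
  have h4 := Nat.mul_le_mul_left n h1
  have h5 := Nat.mul_le_mul_left n h2
  have h6 : n * 4 + scanTime n + 30 ≤ (n * 4 + scanTime n + 30) * D := Nat.le_mul_of_pos_right _ hD
  unfold coreTime
  nlinarith

open Classical in
theorem runs_cover (n : ℕ) (G : SimpleGraph (Fin n)) (k : ℕ) :
    ∃ (t : ℕ) (s : State), Runs cover (graphInput G k) t s ∧
      s.reg 0 = (if CoveredByIndepSets G k then 1 else 0) ∧
      t ≤ coverPoly.eval n * (dominators n (graphInput G k).mem n).length + Nat.size k := by
  set D := (dominators n (graphInput G k).mem n).length with hDdef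
  have hD : 0 < D := length_dominators_pos _ _
  have hsize : Nat.size n ≤ n := Nat.size_le.2 Nat.lt_two_pow_self
  have hn : (graphInput G k).reg 0 = n := rfl
  have hk : (graphInput G k).reg 1 = k := rfl
  have hpoly : 3 * n + 10 ≤ coverPoly.eval n * D := by
    refine le_trans ?_ (Nat.le_mul_of_pos_right _ hD)
    rw [eval_coverPoly]
    exact Nat.le_add_left _ _
  have hsub : Nat.size (n - k) ≤ n := (Nat.size_le_size (Nat.sub_le n k)).trans hsize
  -- Only for `k ≥ n` can `k` be long; it is then read just once, which gives the summand `Nat.size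
  -- k`.
  rcases le_or_gt n k with hnk | hnk
  · refine ⟨_, _, .cond_false ?_ (.set _ _ _), ?_, ?_⟩
    · simp [hn, hk, hnk]
    · simp [coveredByIndepSets_of_le hnk]
    · simp only [Expr.cost, Expr.val, hn, hk, Nat.size_one]
      omega
  · have hsizek : Nat.size k ≤ n := (Nat.size_le_size hnk.le).trans hsize
    have hne : (Expr.sub (.reg 0) (.reg 1)).val (graphInput G k) ≠ 0 := by
      simp only [Expr.val, hn, hk]
      omega
    rcases Nat.eq_zero_or_pos k with hk0 | hk0
    · refine ⟨_, _, .cond_true hne (.cond_false ?_ (.set _ _ _)), ?_, ?_⟩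
      · exact hk.trans hk0
      · subst hk0
        simp [not_coveredByIndepSets_zero hnk]
      · simp only [Expr.cost, Expr.val, hn, hk, Nat.size_zero]
        omega
    -- A power of two as the bound has a known bit length: `unit` becomes `4000 * (n * n + n + 8)`,
    -- the factor in `coverPoly`.
    · have hb : 2 * n + n * n + 5 ≤ 2 ^ (n * n + n + 5) := by
        have h1 : n * n < 2 ^ (n * n) := Nat.lt_two_pow_self
        have h2 : n < 2 ^ n := Nat.lt_two_pow_self
        rw [pow_add, pow_add]
        nlinarith [Nat.mul_le_mul h1 h2]
      have hb' : (2 ^ n) ^ n < 2 ^ (n * n + n + 5) := by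
        rw [← pow_mul]
        exact Nat.pow_lt_pow_right (by norm_num) (by omega)
      obtain ⟨s, ⟨t, hrun, ht⟩, hs⟩ := ex_core (graphInput_mem_le G k) hk0 hnk hb hb'
      rw [← graphInput_eq_St] at hrun
      refine ⟨_, s, .cond_true hne (.cond_true ?_ hrun), ?_, ?_⟩
      · simp only [Expr.val, hk]
        omega
      · rw [hs]
        split_ifs with h
        · have := covers_ne_zero_iff.2 h
          omega
        · have := mt covers_ne_zero_iff.1 h
          omega
      · have h1 := ht.trans (Nat.mul_le_mul_right _ (coreTime_le hnk.le hD))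
        rw [Ram.unit, Nat.size_pow, show n * n + n + 5 + 1 + 2 = n * n + n + 8 by ring,
          mul_right_comm] at h1
        have h2 : 3 * n + 10 ≤ (3 * n + 10) * D := Nat.le_mul_of_pos_right _ hD
        rw [eval_coverPoly, add_mul]
        simp only [Expr.cost, Expr.val, hn, hk]
        linarith

end Ram

open Classical in
theorem mainTheorem6 :
    ∃ (P : Ram.Prog) (p : Polynomial ℕ) (c : ℕ),
      ∀ (n : ℕ) (G : SimpleGraph (Fin n)) (k : ℕ),
        ∃ (t : ℕ) (s : Ram.State),
          Ram.Runs P (Ram.graphInput G k) t s ∧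
          s.reg 0 = (if CoveredByIndepSets G k then 1 else 0) ∧
          (t : ℝ) ≤ ((p.eval n : ℕ) : ℝ) *
              ((2 : ℝ) ^ (G.maxDegree + 1) - 1) ^ ((n : ℝ) / ((G.maxDegree : ℝ) + 1))
            + c * Nat.size k := by
  refine ⟨Ram.cover, Ram.coverPoly, 1, fun n G k => ?_⟩
  obtain ⟨t, s, hrun, hs, ht⟩ := Ram.runs_cover n G k
  refine ⟨t, s, hrun, hs, ?_⟩
  have h := mul_le_mul_of_nonneg_left (Ram.length_dominators_le_rpow (G := G) (k := k))
    (Nat.cast_nonneg (α := ℝ) (Ram.coverPoly.eval n))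
  have h' : (t : ℝ) ≤ (Ram.coverPoly.eval n : ℕ) *
      ((Ram.dominators n (Ram.graphInput G k).mem n).length : ℝ) + Nat.size k := by
    exact_mod_cast ht
  rw [Nat.cast_one, one_mul]
  linarith
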